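/- Let $m,n\ge 1$, let $\beta\in\{1,2,4\}$, and let $\mathbb K=\mathbb R,\mathbb C,\mathbb H$ for $\beta=1,2,4$, respectively. On a probability space, let $X$ be a random $m\times n$ matrix whose entries are independent standard normal variables with values in $\mathbb K$, that is, the $\beta$ real components of each entry are independent $N(0,1)$ variables, so that $\mathbb E|X_{11}|^2=\beta$. Let $\Gamma$ be an $m\times m$ matrix with entries in $\mathbb K$, either deterministic or random but independent of $X$, such that almost surely $\Gamma=\Gamma^*\ge 0$ and $\operatorname{rank}\Gamma=1$. Let $$l=\|\Gamma\|_{HS}=\Bigl(\sum_{j,k=1}^m|\Gamma_{jk}|^2\Bigr)^{1/2},\qquad \widetilde H=\begin{pmatrix}\Gamma & X\\ X^*&\mathbf 0_{n\times n}\end{pmatrix}.$$ Then $\widetilde H$ is unitarily equivalent to $J+l\,I_{1\times1}$ in the following sense. There are a random $(m+n)\times(m+n)$ matrix $W$ with entries in $\mathbb K$, measurable and unitary ($WW^*=W^*W=\mathbf 1$), and a random real matrix $J$, independent of $\Gamma$, on the same probability space, such that almost surely $$W\,\widetilde H\,W^*=J+l\,I_{1\times 1}.$$ Here $I_{1\times1}$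 is the $(m+n)\times(m+n)$ matrix with $1$ in the $(1,1)$ entry and $0$ elsewhere, and $J$ is the $(m+n)\times(m+n)$ symmetric tridiagonal matrix with zero diagonal and with successive off-diagonal entries * $x_1,y_1,x_2,y_2,\dots,y_{m-1},x_m,0,\dots,0$ if $m\le n$, * $x_1,y_1,x_2,y_2,\dots,x_n,y_n,0,\dots,0$ if $m\ge n+1$, where all the $x_j$ and $y_j$ that occur are independent, with $x_j\sim\chi_{\beta(n-j+1)}$ and $y_j\sim\chi_{\beta(m-j)}$. For $\alpha>0$, $\chi_\alpha$ denotes the distribution with density $\frac{1}{2^{\alpha/2-1}\Gamma(\alpha/2)}\,x^{\alpha-1}e^{-x^2/2}$ on $x>0$. -/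

import Mathlib

open MeasureTheory ProbabilityTheory Matrix
open scoped ComplexOrder Quaternion

noncomputable section

namespace ChiralEnsemble

/-! ### Quaternions and matrices as measurable spaces; nonnegative quaternions -/

/-- The Borel sigma-algebra on the quaternions. -/
instance quaternionMeasurableSpace : MeasurableSpace ℍ[ℝ] := borel ℍ[ℝ]

instance quaternionBorelSpace : BorelSpace ℍ[ℝ] := ⟨rfl⟩

/-- `a ≤ b` for quaternions means that `b - a` is a nonnegative real number; this is the analogue
of the order that Mathlib uses on the complex numbers, and it is what `Matrix.PosSemidef`
refers to for quaternionic matrices. -/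
instance quaternionPartialOrder : PartialOrder ℍ[ℝ] where
  le a b := a.re ≤ b.re ∧ a.imI = b.imI ∧ a.imJ = b.imJ ∧ a.imK = b.imK
  le_refl a := ⟨le_refl _, rfl, rfl, rfl⟩
  le_trans _ _ _ h h' :=
    ⟨h.1.trans h'.1, h.2.1.trans h'.2.1, h.2.2.1.trans h'.2.2.1, h.2.2.2.trans h'.2.2.2⟩
  le_antisymm _ _ h h' := Quaternion.ext _ _ (h.1.antisymm h'.1) h.2.1 h.2.2.1 h.2.2.2

/-- A matrix is measured through its entries (product sigma-algebra). -/
instance matrixMeasurableSpace {ι κ K : Type*} [MeasurableSpace K] :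
    MeasurableSpace (Matrix ι κ K) :=
  inferInstanceAs (MeasurableSpace (ι → κ → K))

/-! ### Matrices over the reals, the complex numbers or the quaternions -/

/-- The rank of a matrix over a possibly noncommutative division ring: the dimension of the right
vector space spanned by its columns. -/
def colRank {ι κ K : Type*} [DivisionRing K] (A : Matrix ι κ K) : ℕ :=
  Module.finrank Kᵐᵒᵖ (Submodule.span Kᵐᵒᵖ (Set.range A.col))

/-- The Hilbert-Schmidt norm of a square matrix. -/
def hsNorm {m : ℕ} {K : Type*} [Norm K] (A : Matrix (Fin m) (Fin m) K) : ℝ :=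
  Real.sqrt (∑ j, ∑ k, ‖A j k‖ ^ 2)

/-- The `(m + n) × (m + n)` block matrix with blocks `Γ`, `X`, `X*` and `0`. -/
def chiralPert {m n : ℕ} {K : Type*} [Ring K] [StarRing K]
    (Γ : Matrix (Fin m) (Fin m) K) (X : Matrix (Fin m) (Fin n) K) :
    Matrix (Fin (m + n)) (Fin (m + n)) K :=
  Matrix.reindex finSumFinEquiv finSumFinEquiv (Matrix.fromBlocks Γ X Xᴴ 0)

/-- The matrix with `1` in the upper left corner and `0` everywhere else. -/
def corner (N : ℕ) : Matrix (Fin N) (Fin N) ℝ :=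
  Matrix.of fun i j => if (i : ℕ) = 0 ∧ (j : ℕ) = 0 then 1 else 0

/-- The off-diagonal entries `x₀, y₀, x₁, y₁, …` of the Jacobi matrix, followed by zeros.
If `m ≤ n` there are `m` entries `x` and `m - 1` entries `y`; if `m ≥ n + 1` there are `n` of
each. In both cases these numbers are `min m n` and `min (m - 1) n`. -/
def offDiag (m n : ℕ) (x : Fin (min m n) → ℝ) (y : Fin (min (m - 1) n) → ℝ) (k : ℕ) : ℝ :=
  if k % 2 = 0 then
    if h : k / 2 < min m n then x ⟨k / 2, h⟩ else 0
  else
    if h : k / 2 < min (m - 1) n then y ⟨k / 2, h⟩ else 0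

/-- The `(m + n) × (m + n)` symmetric tridiagonal matrix with zero diagonal and off-diagonal
entries `x₀, y₀, x₁, y₁, …`, bordered by zeros: the nonzero block has size `2 m` if `m ≤ n` and
`2 n + 1` if `m ≥ n + 1`. -/
def jacobi (m n : ℕ) (x : Fin (min m n) → ℝ) (y : Fin (min (m - 1) n) → ℝ) :
    Matrix (Fin (m + n)) (Fin (m + n)) ℝ :=
  Matrix.of fun i j =>
    if (j : ℕ) = i + 1 then offDiag m n x y i
    else if (i : ℕ) = j + 1 then offDiag m n x y j
    else 0

/-! ### Random matrices -/

/-- The chi distribution with parameter `α > 0`, given by its density. -/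
def chiMeasure (α : ℝ) : Measure ℝ :=
  volume.withDensity fun x => ENNReal.ofReal
    (if 0 < x then
      1 / (2 ^ (α / 2 - 1) * Real.Gamma (α / 2)) * x ^ (α - 1) * Real.exp (-x ^ 2 / 2)
    else 0)

/-- The entries of the random matrix `X` are independent, and each of them is a standard normal
variable with values in `K` (the real components with respect to an orthonormal basis of `K` over
`ℝ` are independent standard real normal variables), so that the expectation of the square of its
absolute value is the real dimension `β` of `K`. -/
structure IsGaussianMatrix {Ω K : Type*} [MeasurableSpace Ω] [NormedAddCommGroup K]
    [InnerProductSpace ℝ K] [FiniteDimensional ℝ K] [MeasurableSpace K] {m n : ℕ}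
    (X : Ω → Matrix (Fin m) (Fin n) K) (P : Measure Ω) : Prop where
  measurable : Measurable X
  law : ∀ i j, HasLaw (fun ω => X ω i j) (stdGaussian K) P
  indep : iIndepFun (fun (p : Fin m × Fin n) (ω : Ω) => X ω p.1 p.2) P

/-- The random variables `x_j ∼ χ_{β (n - j + 1)}` and `y_j ∼ χ_{β (m - j)}`, `j = 1, 2, …`, are
all independent. (The indices of `Fin` start at `0`, so `j` is shifted by one.) -/
structure IsJacobiData {Ω : Type*} [MeasurableSpace Ω] (β : ℝ) (m n : ℕ)
    (x : Fin (min m n) → Ω → ℝ) (y : Fin (min (m - 1) n) → Ω → ℝ) (P : Measure Ω) : Prop where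
  measurable_x : ∀ j, Measurable (x j)
  measurable_y : ∀ j, Measurable (y j)
  law_x : ∀ j, HasLaw (x j) (chiMeasure (β * ((n : ℝ) - (j : ℕ)))) P
  law_y : ∀ j, HasLaw (y j) (chiMeasure (β * ((m : ℝ) - ((j : ℕ) + 1)))) P
  indep : iIndepFun (fun (s : Fin (min m n) ⊕ Fin (min (m - 1) n)) => Sum.elim x y s) P

end ChiralEnsemble

end

open ChiralEnsemble

/-!
# Jacobi form of a chiral Gaussian matrix with a rank one perturbation

The real, complex and quaternionic cases are treated together, for a division ring `K` with a real
inner product and an involution such that the real numbers are central and `a * star a = ‖a‖ ^ 2`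
(`IsStarNormedAlgebra`); then `β` is the real dimension of `K`.

A nonnegative matrix `Γ` of rank one is `t c c*`, where `c` is any of its columns through a nonzero
diagonal entry (`rank_one_eq_smul_vecMulVec`). A unitary `V` that depends measurably on `c` and maps
`c` to `‖c‖ e₁` (`exists_measurable_unitary_mulVec`, a Householder reflection) turns `Γ` into
`‖Γ‖_HS e₁ e₁*` and `X` into `V X`. Since the law of `X` is invariant under unitary matrices and `X`
is independent of `Γ`, the matrix `V X` is again Gaussian and independent of `Γ`
(`indepFun_and_hasLaw_unitary_mul`). It remains to tridiagonalize the chiral matrix of a Gaussian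
`X` by a unitary that fixes `e₁`, because such a unitary preserves the corner matrix `e₁ e₁*`.

This is an induction on the size (`exists_tridiagonalization`). Let `r` be the first row of the
`(m + 1) × n` matrix `X` and `Y` the matrix of the other rows. With a unitary `V` such that
`V r* = ‖r‖ e₁`, conjugation by `1 ⊕ V ⊕ 1` (on the first row, the columns and the other rows)
leaves the first off-diagonal entry `‖r‖` and, in the remaining indices, the chiral matrix of the
`n × m` matrix `V Y*`, whose own first basis vector is the one coupled to `e₁`. As `Y` is
Gaussian and independent of `r`, the matrix `V Y*` is Gaussian and independent of `‖r‖`, so that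
the off-diagonal entries are independent. The roles of rows and columns alternate, which produces `x₁, y₁, x₂, y₂, …`. The norm of a Gaussian row of
length `n` is `χ_{β n}` distributed by polar coordinates (`map_norm_stdGaussian`).
-/

namespace ChiralEnsemble

/-! ### The standard Gaussian measure: density, radial law, product structure -/

section GaussianMeasure

variable {E : Type*} [NormedAddCommGroup E] [InnerProductSpace ℝ E] [FiniteDimensional ℝ E]
  [MeasurableSpace E] [BorelSpace E]

/-- The standard Gaussian measure has the expected density: the characteristic functions agree. -/
lemma stdGaussian_eq_withDensity :
    stdGaussian E = volume.withDensity fun v : E =>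
      ENNReal.ofReal ((2 * Real.pi) ^ (-(Module.finrank ℝ E / 2 : ℝ)) *
        Real.exp (-‖v‖ ^ 2 / 2)) := by
  set C : ℝ := (2 * Real.pi) ^ (-(Module.finrank ℝ E / 2 : ℝ)) with hC
  have hC0 : 0 < C := by positivity
  have hint : Integrable (fun v : E => C * Real.exp (-‖v‖ ^ 2 / 2)) := by
    refine Integrable.const_mul ?_ C
    have h := (GaussianFourier.integrable_cexp_neg_mul_sq_norm_add (V := E) (b := (1 / 2 : ℂ))
      (by norm_num) 0 0).norm
    refine h.congr (Filter.Eventually.of_forall fun v => ?_)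
    simp only [Complex.norm_exp]
    congr 1
    have : (-(1 / 2 : ℂ) * (‖v‖ : ℂ) ^ 2 + 0 * ((inner ℝ 0 v : ℝ) : ℂ)) =
        ((-‖v‖ ^ 2 / 2 : ℝ) : ℂ) := by
      push_cast; ring
    rw [this, Complex.ofReal_re]
  have := isFiniteMeasure_withDensity_ofReal hint.2
  apply Measure.ext_of_charFun
  ext t
  rw [charFun_stdGaussian, charFun_apply, integral_withDensity_eq_integral_toReal_smul
    (by fun_prop) (by simp)]
  have h := GaussianFourier.integral_cexp_neg_mul_sq_norm_add (V := E) (b := (1 / 2 : ℂ))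
    (by norm_num) Complex.I t
  have h1 : ∀ v : E, (ENNReal.ofReal (C * Real.exp (-‖v‖ ^ 2 / 2))).toReal •
      Complex.exp ((inner ℝ v t : ℝ) * Complex.I) =
      C * Complex.exp (-(1 / 2 : ℂ) * (‖v‖ : ℂ) ^ 2 + Complex.I * ((inner ℝ t v : ℝ) : ℂ)) := by
    intro v
    rw [ENNReal.toReal_ofReal (by positivity), Complex.real_smul, Complex.exp_add,
      real_inner_comm t v]
    push_cast
    rw [mul_assoc]
    congr 3
    · ring_nf
    · ring_nf
  simp_rw [h1]
  rw [integral_const_mul, h, ← mul_assoc]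
  have h2 : (C : ℂ) * ((Real.pi : ℂ) / (1 / 2)) ^ (Module.finrank ℝ E / 2 : ℂ) = 1 := by
    have : ((Real.pi : ℂ) / (1 / 2)) ^ (Module.finrank ℝ E / 2 : ℂ) =
        (((2 * Real.pi) ^ (Module.finrank ℝ E / 2 : ℝ) : ℝ) : ℂ) := by
      rw [Complex.ofReal_cpow (by positivity)]
      push_cast
      congr 1
      ring
    rw [this, ← Complex.ofReal_mul, hC, ← Real.rpow_add (by positivity)]
    simp
  rw [h2, one_mul, Complex.I_sq]
  congr 1
  ring

/-- The norm of a standard Gaussian vector is chi distributed, by polar coordinates. -/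
lemma map_norm_stdGaussian (hE : 0 < Module.finrank ℝ E) :
    (stdGaussian E).map (fun v => ‖v‖) = chiMeasure (Module.finrank ℝ E) := by
  have : Nontrivial E := Module.finrank_pos_iff.mp hE
  set d := Module.finrank ℝ E with hd
  set C : ℝ := (2 * Real.pi) ^ (-(d / 2 : ℝ)) with hC
  have hC0 : 0 < C := by positivity
  have hd0 : (0 : ℝ) < d := by exact_mod_cast hE
  set g : ℝ → ℝ := fun y => C * Real.exp (-y ^ 2 / 2) with hg
  have hdens := stdGaussian_eq_withDensity (E := E)
  rw [← hd, ← hC] at hdens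
  have hgint : Integrable (fun v : E => g ‖v‖) := by
    have h1 : (volume.withDensity fun v : E => ENNReal.ofReal (g ‖v‖)) Set.univ ≠ ⊤ := by
      rw [← hdens]; exact measure_ne_top _ _
    rw [withDensity_apply _ MeasurableSet.univ, Measure.restrict_univ] at h1
    exact (lintegral_ofReal_ne_top_iff_integrable (by fun_prop)
      (Filter.Eventually.of_forall fun v => by positivity)).1 h1
  have hvol : (volume : Measure E).real (Metric.ball 0 1) =
      √Real.pi ^ d / Real.Gamma (d / 2 + 1) := by
    rw [Measure.real, InnerProductSpace.volume_ball, ENNReal.ofReal_one, one_pow, one_mul,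
      ENNReal.toReal_ofReal]
    positivity
  -- the factor in front of the radial integral is the normalization of the chi density
  have hconst : d * (√Real.pi ^ d / Real.Gamma (d / 2 + 1)) * C =
      1 / (2 ^ ((d : ℝ) / 2 - 1) * Real.Gamma (d / 2)) := by
    rw [Real.Gamma_add_one (by positivity), hC, Real.rpow_neg (by positivity),
      Real.mul_rpow (by norm_num) Real.pi_pos.le, Real.rpow_sub_one (by norm_num),
      Real.sqrt_eq_rpow, ← Real.rpow_natCast, ← Real.rpow_mul Real.pi_pos.le]
    have h1 : 0 < Real.Gamma ((d : ℝ) / 2) := Real.Gamma_pos_of_pos (by positivity)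
    have h2 : (1 / 2 * (d : ℝ)) = d / 2 := by ring
    rw [h2]
    have h3 : 0 < Real.pi ^ ((d : ℝ) / 2) := by positivity
    field_simp
  ext A hA
  rw [Measure.map_apply (by fun_prop) hA, hdens, withDensity_apply _ (hA.preimage (by fun_prop)),
    chiMeasure, withDensity_apply _ hA]
  have hchi : ∀ y : ℝ, (if 0 < y then
      1 / (2 ^ ((d : ℝ) / 2 - 1) * Real.Gamma (d / 2)) * y ^ ((d : ℝ) - 1) *
        Real.exp (-y ^ 2 / 2) else 0) =
      (Set.Ioi 0).indicator (fun y : ℝ => d * (√Real.pi ^ d / Real.Gamma (d / 2 + 1)) *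
        (y ^ (d - 1) • g y)) y := by
    intro y
    by_cases hy : 0 < y
    · have hpow : y ^ ((d : ℝ) - 1) = y ^ (d - 1) := by
        rw [← Real.rpow_natCast, Nat.cast_sub hE, Nat.cast_one]
      rw [Set.indicator_of_mem (Set.mem_Ioi.2 hy), if_pos hy, ← hconst, hpow]
      simp only [smul_eq_mul, hg]
      ring
    · rw [Set.indicator_of_notMem (by simpa using hy), if_neg hy]
  have hIoi := (integrable_fun_norm_addHaar (volume : Measure E) (f := g)).1 hgint
  simp_rw [hchi]
  rw [← ofReal_integral_eq_lintegral_ofReal hgint.integrableOn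
    (Filter.Eventually.of_forall fun v => by positivity),
    ← ofReal_integral_eq_lintegral_ofReal]
  · congr 1
    have h1 : ∫ v in (fun v : E => ‖v‖) ⁻¹' A, C * Real.exp (-‖v‖ ^ 2 / 2) =
        ∫ v : E, A.indicator g ‖v‖ := by
      rw [← integral_indicator (hA.preimage (by fun_prop))]
      rfl
    rw [h1, integral_fun_norm_addHaar, hvol, ← integral_indicator hA, ← hd, nsmul_eq_mul,
      smul_eq_mul, ← mul_assoc, ← integral_indicator measurableSet_Ioi, ← integral_const_mul]
    congr 1
    ext y
    by_cases hy : 0 < y <;> by_cases hyA : y ∈ A <;> simp [Set.indicator, hy, hyA]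
  · exact ((integrable_indicator_iff measurableSet_Ioi).2
      (hIoi.const_mul _)).integrableOn
  · refine Filter.Eventually.of_forall fun y => Set.indicator_nonneg (fun y hy => ?_) y
    have : 0 < y := hy
    have : 0 < Real.Gamma ((d : ℝ) / 2 + 1) := Real.Gamma_pos_of_pos (by positivity)
    simp only [smul_eq_mul, hg]
    positivity

/-- Independent standard Gaussian vectors form a standard Gaussian vector of the `ℓ²` product. -/
lemma map_toLp_pi_stdGaussian {ι : Type*} [Fintype ι] :
    (Measure.pi fun _ : ι => stdGaussian E).map (WithLp.toLp 2) =
      stdGaussian (PiLp 2 fun _ : ι => E) := by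
  have : IsProbabilityMeasure ((Measure.pi fun _ : ι => stdGaussian E).map
    (WithLp.toLp (V := ι → E) 2)) := Measure.isProbabilityMeasure_map (by fun_prop)
  apply Measure.ext_of_charFun (E := PiLp 2 fun _ : ι => E)
  ext t
  rw [charFun_pi, charFun_stdGaussian]
  simp_rw [charFun_stdGaussian]
  rw [← Complex.exp_sum, ← Complex.ofReal_pow, PiLp.norm_sq_eq_of_L2]
  simp [Finset.sum_div, neg_div]

/-- A linear bijection of `E^ι` that preserves the `ℓ²` norm preserves the product Gaussian. -/
lemma measurePreserving_pi_stdGaussian {ι : Type*} [Fintype ι] (f : (ι → E) ≃ₗ[ℝ] (ι → E))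
    (hf : ∀ v, ∑ i, ‖f v i‖ ^ 2 = ∑ i, ‖v i‖ ^ 2) :
    MeasurePreserving f (Measure.pi fun _ : ι => stdGaussian E)
      (Measure.pi fun _ : ι => stdGaussian E) := by
  let e := WithLp.linearEquiv 2 ℝ (ι → E)
  let F : (PiLp 2 fun _ : ι => E) ≃ₗᵢ[ℝ] (PiLp 2 fun _ : ι => E) :=
    ⟨e.trans (f.trans e.symm), fun v => by
      rw [← sq_eq_sq₀ (norm_nonneg _) (norm_nonneg _), PiLp.norm_sq_eq_of_L2,
        PiLp.norm_sq_eq_of_L2]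
      exact hf v.ofLp⟩
  have hfm : Measurable f := f.toLinearMap.continuous_of_finiteDimensional.measurable
  refine ⟨hfm, ?_⟩
  have h := stdGaussian_map F
  rw [← map_toLp_pi_stdGaussian, Measure.map_map (by fun_prop) (by fun_prop)] at h
  have h2 : (F ∘ WithLp.toLp 2 : (ι → E) → _) = WithLp.toLp 2 ∘ f := rfl
  rw [h2, ← Measure.map_map (by fun_prop) hfm] at h
  exact (MeasurableEquiv.toLp 2 (ι → E)).map_measurableEquiv_injective h

/-- The `ℓ²` norm of `n` independent standard Gaussian vectors is chi distributed. -/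
lemma map_sqrt_sum_pi_stdGaussian {n : ℕ} (hn : 0 < n) (hE : 0 < Module.finrank ℝ E) :
    (Measure.pi fun _ : Fin n => stdGaussian E).map (fun v => √(∑ i, ‖v i‖ ^ 2)) =
      chiMeasure (Module.finrank ℝ E * n) := by
  have h1 : Module.finrank ℝ (PiLp 2 fun _ : Fin n => E) = Module.finrank ℝ E * n := by
    rw [LinearEquiv.finrank_eq (WithLp.linearEquiv 2 ℝ (Fin n → E)), Module.finrank_pi_fintype]
    simp [mul_comm]
  have h := map_norm_stdGaussian (E := PiLp 2 fun _ : Fin n => E) (by rw [h1]; positivity)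
  rw [h1, ← map_toLp_pi_stdGaussian, Measure.map_map (by fun_prop) (by fun_prop)] at h
  push_cast at h
  rw [← h]
  congr 1
  ext v
  simp [PiLp.norm_eq_of_L2]

end GaussianMeasure

/-! ### The common framework for the real, complex and quaternionic cases -/

/-- The properties of `ℝ`, `ℂ` and `ℍ` that the argument uses: a normed division ring with a real
inner product and an involution, such that real scalars are central and fixed by the involution
and `a * star a = star a * a = ‖a‖ ^ 2`. The real numbers enter as the multiples `r • 1`. -/
class IsStarNormedAlgebra (K : Type*) [NormedDivisionRing K] [InnerProductSpace ℝ K]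
    [StarRing K] : Prop extends IsScalarTower ℝ K K, SMulCommClass ℝ K K, StarModule ℝ K where
  mul_star_self (a : K) : a * star a = (‖a‖ ^ 2 : ℝ) • (1 : K)
  star_mul_self (a : K) : star a * a = (‖a‖ ^ 2 : ℝ) • (1 : K)

lemma smul_one_injective {K : Type*} [NormedDivisionRing K] [InnerProductSpace ℝ K] :
    Function.Injective fun r : ℝ => r • (1 : K) :=
  smul_left_injective ℝ one_ne_zero

section Framework

variable {K : Type*} [NormedDivisionRing K] [InnerProductSpace ℝ K] [StarRing K]
  [IsStarNormedAlgebra K]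

open IsStarNormedAlgebra

lemma norm_star' (a : K) : ‖star a‖ = ‖a‖ := by
  rcases eq_or_ne a 0 with rfl | ha
  · simp
  · have h := congrArg norm (mul_star_self a)
    rw [norm_mul, norm_smul, norm_one, mul_one, Real.norm_eq_abs, abs_of_nonneg (by positivity),
      sq] at h
    exact mul_left_cancel₀ (norm_ne_zero_iff.2 ha) h

lemma measurable_star' [MeasurableSpace K] [BorelSpace K] : Measurable (star : K → K) := by
  have h : Isometry (starAddEquiv : K ≃+ K) :=
    AddMonoidHomClass.isometry_of_norm _ fun a => norm_star' a
  exact h.continuous.measurable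

lemma dotProduct_star_self {ι : Type*} [Fintype ι] (v : ι → K) :
    v ⬝ᵥ star v = (∑ i, ‖v i‖ ^ 2 : ℝ) • (1 : K) := by
  simp [dotProduct, mul_star_self, Finset.sum_smul]

lemma star_dotProduct_self {ι : Type*} [Fintype ι] (v : ι → K) :
    star v ⬝ᵥ v = (∑ i, ‖v i‖ ^ 2 : ℝ) • (1 : K) := by
  simp [dotProduct, star_mul_self, Finset.sum_smul]

lemma sum_norm_sq_vecMul {n : ℕ} {V : Matrix (Fin n) (Fin n) K} (hV : V * Vᴴ = 1)
    (v : Fin n → K) : ∑ j, ‖(v ᵥ* V) j‖ ^ 2 = ∑ j, ‖v j‖ ^ 2 := by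
  apply smul_one_injective (K := K)
  simp only
  rw [← dotProduct_star_self, ← dotProduct_star_self, star_vecMul, dotProduct_mulVec,
    vecMul_vecMul, hV, vecMul_one]

end Framework

/-! ### Measurability of matrix operations -/

lemma measurable_matrix_iff {K α ι κ : Type*} [MeasurableSpace K] [MeasurableSpace α]
    {f : α → Matrix ι κ K} : Measurable f ↔ ∀ i j, Measurable fun a => f a i j :=
  measurable_pi_iff.trans (forall_congr' fun _ => measurable_pi_iff)

lemma _root_.Measurable.matrix_apply {K α ι κ : Type*} [MeasurableSpace K] [MeasurableSpace α]
    {f : α → Matrix ι κ K} (hf : Measurable f) (i : ι) (j : κ) : Measurable fun a => f a i j :=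
  measurable_matrix_iff.1 hf i j

lemma measurable_uncurry_matrix {K ι κ : Type*} [MeasurableSpace K] :
    Measurable fun (X : Matrix ι κ K) (p : ι × κ) => X p.1 p.2 :=
  measurable_pi_iff.2 fun p => measurable_id.matrix_apply p.1 p.2

section Measurability

variable {K : Type*} [NormedDivisionRing K] [MeasurableSpace K] [BorelSpace K]
  {α : Type*} [MeasurableSpace α] {ι κ l : Type*}

lemma _root_.Measurable.matrix_mul [SecondCountableTopology K] [Fintype κ]
    {f : α → Matrix ι κ K} {g : α → Matrix κ l K}
    (hf : Measurable f) (hg : Measurable g) : Measurable fun a => f a * g a := by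
  refine measurable_matrix_iff.2 fun i j => ?_
  simp only [Matrix.mul_apply]
  exact Finset.measurable_sum _ fun k _ => (hf.matrix_apply i k).mul (hg.matrix_apply k j)

lemma _root_.Measurable.matrix_conjTranspose [InnerProductSpace ℝ K] [StarRing K]
    [IsStarNormedAlgebra K] {f : α → Matrix ι κ K}
    (hf : Measurable f) : Measurable fun a => (f a)ᴴ :=
  measurable_matrix_iff.2 fun i j => measurable_star'.comp (hf.matrix_apply j i)

end Measurability

/-! ### Gaussian matrices and their invariance -/

section GaussianMatrix

variable (K : Type*) [NormedDivisionRing K] [InnerProductSpace ℝ K] [FiniteDimensional ℝ K]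
  [MeasurableSpace K]

/-- The law of one row of a Gaussian matrix. -/
noncomputable def gaussRow (n : ℕ) : Measure (Fin n → K) := Measure.pi fun _ => stdGaussian K

/-- The law of an `m × n` matrix of independent standard Gaussian entries, as a product over the
rows. -/
noncomputable def gaussMat (m n : ℕ) : Measure (Matrix (Fin m) (Fin n) K) :=
  Measure.pi fun _ : Fin m => gaussRow K n

variable [BorelSpace K]

instance (n : ℕ) : IsProbabilityMeasure (gaussRow K n) := by
  unfold gaussRow; infer_instance

instance (m n : ℕ) : IsProbabilityMeasure (gaussMat K m n) :=
  inferInstanceAs (IsProbabilityMeasure (Measure.pi fun _ : Fin m => gaussRow K n))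

variable {K}

/-- The entries of a Gaussian matrix, listed in one array, have the product law. -/
lemma map_uncurry_gaussMat (m n : ℕ) :
    (gaussMat K m n).map (fun X (p : Fin m × Fin n) => X p.1 p.2) =
      Measure.pi fun _ => stdGaussian K := by
  refine (Measure.pi_eq fun s hs => ?_).symm
  rw [Measure.map_apply measurable_uncurry_matrix (MeasurableSet.univ_pi hs)]
  have h : (fun (X : Matrix (Fin m) (Fin n) K) (p : Fin m × Fin n) => X p.1 p.2) ⁻¹'
      Set.univ.pi s = Set.univ.pi fun i => Set.univ.pi fun j => s (i, j) := by
    ext X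
    exact ⟨fun h i _ j _ => h (i, j) trivial, fun h p _ => h p.1 trivial p.2 trivial⟩
  rw [h]
  refine (Measure.pi_pi _ _).trans ?_
  rw [Fintype.prod_prod_type]
  exact Finset.prod_congr rfl fun i _ => Measure.pi_pi _ _

/-- A measure on matrices is determined by the law of the array of entries. -/
lemma eq_gaussMat_of_map_uncurry {m n : ℕ} {μ : Measure (Matrix (Fin m) (Fin n) K)}
    (h : μ.map (fun X (p : Fin m × Fin n) => X p.1 p.2) = Measure.pi fun _ => stdGaussian K) :
    μ = gaussMat K m n :=
  (MeasurableEquiv.curry (Fin m) (Fin n) K).symm.map_measurableEquiv_injective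
    (h.trans (map_uncurry_gaussMat m n).symm)

lemma IsGaussianMatrix.map_eq {Ω : Type*} [MeasurableSpace Ω] {P : Measure Ω}
    [IsProbabilityMeasure P] {m n : ℕ} {X : Ω → Matrix (Fin m) (Fin n) K}
    (hX : IsGaussianMatrix X P) : P.map X = gaussMat K m n := by
  apply eq_gaussMat_of_map_uncurry
  rw [Measure.map_map measurable_uncurry_matrix hX.measurable]
  exact (hX.indep.hasLaw_pi fun p : Fin m × Fin n => hX.law p.1 p.2).map_eq

lemma measurePreserving_firstRow (m n : ℕ) :
    MeasurePreserving (fun X : Matrix (Fin (m + 1)) (Fin n) K =>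
      (X 0, (Matrix.of fun i j => X i.succ j : Matrix (Fin m) (Fin n) K)))
      (gaussMat K (m + 1) n) ((gaussRow K n).prod (gaussMat K m n)) :=
  measurePreserving_piFinSuccAbove (fun _ : Fin (m + 1) => gaussRow K n) 0

variable [StarRing K] [IsStarNormedAlgebra K]

lemma map_star_stdGaussian : (stdGaussian K).map star = stdGaussian K :=
  stdGaussian_map (E := K) (F := K)
    ⟨⟨⟨⟨star, star_add⟩, fun r a => by simp⟩, star, star_star, star_star⟩, norm_star'⟩

lemma measurePreserving_conjTranspose (m n : ℕ) :
    MeasurePreserving (fun X : Matrix (Fin m) (Fin n) K => Xᴴ) (gaussMat K m n)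
      (gaussMat K n m) := by
  have hc : Measurable fun X : Matrix (Fin m) (Fin n) K => Xᴴ :=
    measurable_id.matrix_conjTranspose
  refine ⟨hc, eq_gaussMat_of_map_uncurry ?_⟩
  rw [Measure.map_map measurable_uncurry_matrix hc]
  refine (Measure.pi_eq fun s hs => ?_).symm
  rw [Measure.map_apply (measurable_uncurry_matrix.comp hc) (MeasurableSet.univ_pi hs)]
  have h : ((fun (X : Matrix (Fin n) (Fin m) K) (p : Fin n × Fin m) => X p.1 p.2) ∘
      fun X : Matrix (Fin m) (Fin n) K => Xᴴ) ⁻¹'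
      Set.univ.pi s = Set.univ.pi fun i => Set.univ.pi fun j => star ⁻¹' s (j, i) := by
    ext X
    exact ⟨fun h i _ j _ => h (j, i) trivial, fun h p _ => h p.2 trivial p.1 trivial⟩
  rw [h]
  refine (Measure.pi_pi _ _).trans ?_
  rw [Fintype.prod_prod_type_right]
  refine Finset.prod_congr rfl fun i _ => (Measure.pi_pi _ _).trans ?_
  refine Finset.prod_congr rfl fun j _ => ?_
  rw [← Measure.map_apply measurable_star' (hs _), map_star_stdGaussian]

lemma measurePreserving_vecMul {n : ℕ} {V : Matrix (Fin n) (Fin n) K} (hV : V * Vᴴ = 1)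
    (hV' : Vᴴ * V = 1) :
    MeasurePreserving (fun v => v ᵥ* V) (gaussRow K n) (gaussRow K n) :=
  measurePreserving_pi_stdGaussian
    (f := { toFun := fun v => v ᵥ* V
            map_add' := fun v w => add_vecMul V v w
            map_smul' := fun r v => smul_vecMul r v V
            invFun := fun v => v ᵥ* Vᴴ
            left_inv := fun v => by simp only [vecMul_vecMul, hV, vecMul_one]
            right_inv := fun v => by simp only [vecMul_vecMul, hV', vecMul_one] })
    (sum_norm_sq_vecMul hV)

lemma measurePreserving_mul_right (m : ℕ) {n : ℕ} {V : Matrix (Fin n) (Fin n) K}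
    (hV : V * Vᴴ = 1) (hV' : Vᴴ * V = 1) :
    MeasurePreserving (fun X => X * V) (gaussMat K m n) (gaussMat K m n) := by
  have h := measurePreserving_vecMul hV hV'
  have h2 := measurePreserving_pi (fun _ : Fin m => gaussRow K n) (fun _ : Fin m => gaussRow K n)
    fun _ => h
  exact h2

lemma measurePreserving_mul_left {m : ℕ} (n : ℕ) {U : Matrix (Fin m) (Fin m) K}
    (hU : U * Uᴴ = 1) (hU' : Uᴴ * U = 1) :
    MeasurePreserving (fun X => U * X) (gaussMat K m n) (gaussMat K m n) := by
  have h := (measurePreserving_conjTranspose n m).comp ((measurePreserving_mul_right n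
    (V := Uᴴ) (by simpa using hU') (by simpa using hU)).comp
    (measurePreserving_conjTranspose (K := K) m n))
  convert h using 2 with X
  simp

end GaussianMatrix

/-! ### Householder reflections -/

section Householder

variable {K : Type*} [NormedDivisionRing K] [InnerProductSpace ℝ K]

open Classical in
/-- The phase `a / ‖a‖` of `a`, and `1` if `a = 0`. -/
noncomputable def phase (a : K) : K := if a = 0 then 1 else ‖a‖⁻¹ • a

lemma norm_phase (a : K) : ‖phase a‖ = 1 := by
  by_cases ha : a = 0
  · simp [phase, ha]
  · have : ‖a‖ ≠ 0 := norm_ne_zero_iff.2 ha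
    simp [phase, ha, norm_smul, this]

lemma measurable_phase [FiniteDimensional ℝ K] [MeasurableSpace K] [BorelSpace K] :
    Measurable (phase : K → K) :=
  Measurable.ite (measurableSet_singleton 0) measurable_const
    (measurable_norm.inv.smul measurable_id)

variable [StarRing K] {n : ℕ}

/-- The Householder reflection along `w`, that is `1 - 2 ‖w‖⁻² w w*`; it is the identity if
`w = 0`, because then `‖w‖⁻²` is read as zero. -/
noncomputable def householder (w : Fin n → K) : Matrix (Fin n) (Fin n) K :=
  1 - (2 / ∑ i, ‖w i‖ ^ 2 : ℝ) • vecMulVec w (star w)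

variable [IsStarNormedAlgebra K]

lemma mul_star_phase (a : K) : a * star (phase a) = ‖a‖ • (1 : K) := by
  by_cases ha : a = 0
  · simp [ha]
  · have : ‖a‖ ≠ 0 := norm_ne_zero_iff.2 ha
    simp only [phase, ha, if_false, star_smul, star_trivial, mul_smul_comm,
      IsStarNormedAlgebra.mul_star_self, smul_smul]
    congr 1
    field_simp

lemma star_phase_mul_phase (a : K) : star (phase a) * phase a = 1 := by
  simp [IsStarNormedAlgebra.star_mul_self, norm_phase]

lemma phase_mul_star_phase (a : K) : phase a * star (phase a) = 1 := by
  simp [IsStarNormedAlgebra.mul_star_self, norm_phase]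

lemma conjTranspose_householder (w : Fin n → K) : (householder w)ᴴ = householder w := by
  simp [householder, conjTranspose_vecMulVec]

lemma householder_mul_self (w : Fin n → K) : householder w * householder w = 1 := by
  set q : ℝ := ∑ i, ‖w i‖ ^ 2 with hq
  have h : vecMulVec w (star w) * vecMulVec w (star w) = q • vecMulVec w (star w) := by
    rw [vecMulVec_mul_vecMulVec, star_dotProduct_self, ← hq]
    ext i j
    simp [vecMulVec_apply, mul_smul_comm]
  have h2 : (2 / q) * ((2 / q) * q) = 2 / q + 2 / q := by
    rcases eq_or_ne q 0 with h0 | h0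
    · simp [h0]
    · field_simp
      norm_num
  rw [householder, ← hq, sub_mul, mul_sub, mul_sub, one_mul, mul_one, one_mul, smul_mul_smul_comm,
    h, smul_smul, mul_assoc, h2, add_smul]
  abel

/-- A Householder reflection exchanges two vectors of the same length whose inner product is
real. -/
lemma householder_sub_mulVec {a b : Fin n → K} (hab : ∑ i, ‖a i‖ ^ 2 = ∑ i, ‖b i‖ ^ 2) {r : ℝ}
    (hr : star a ⬝ᵥ b = r • (1 : K)) : householder (a - b) *ᵥ a = b := by
  set A : ℝ := ∑ i, ‖a i‖ ^ 2 with hA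
  set w := a - b with hw
  have hr' : star b ⬝ᵥ a = r • (1 : K) := by
    have := congrArg star hr
    rwa [star_dotProduct, star_star, star_smul, star_one, star_trivial r] at this
  have h1 : star w ⬝ᵥ a = (A - r) • (1 : K) := by
    rw [hw, star_sub, sub_dotProduct, hr', star_dotProduct_self, sub_smul]
  have h2 : ∑ i, ‖w i‖ ^ 2 = 2 * (A - r) := by
    apply smul_one_injective (K := K)
    simp only
    rw [← star_dotProduct_self, hw, dotProduct_sub, ← hw, h1, hw, star_sub, sub_dotProduct, hr,
      star_dotProduct_self, ← hab, ← sub_smul, ← sub_smul]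
    congr 1
    ring
  rw [householder, sub_mulVec, one_mulVec, smul_mulVec, vecMulVec_mulVec, h1, h2]
  rcases eq_or_ne (A - r) 0 with h0 | h0
  · have hw0 : w = 0 := by
      rw [h0, mul_zero, Finset.sum_eq_zero_iff_of_nonneg fun i _ => by positivity] at h2
      ext i
      simpa using h2 i (Finset.mem_univ i)
    simpa [hw0] using sub_eq_zero.1 (hw.symm.trans hw0)
  · have h3 : (2 / (2 * (A - r)) : ℝ) • MulOpposite.op ((A - r) • (1 : K)) • w = w := by
      ext i
      have h4 : 2 / (2 * (A - r)) * (A - r) = 1 := by field_simp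
      simp only [Pi.smul_apply, MulOpposite.smul_eq_mul_unop, MulOpposite.unop_op, mul_smul_comm,
        mul_one, smul_smul, h4, one_smul]
    rw [h3, hw]
    abel

variable [FiniteDimensional ℝ K] [MeasurableSpace K] [BorelSpace K]

lemma measurable_householder : Measurable (householder : (Fin n → K) → _) := by
  refine measurable_matrix_iff.2 fun i j => ?_
  simp only [householder, Matrix.sub_apply, Matrix.smul_apply, vecMulVec_apply, Pi.star_apply]
  have h : Measurable fun w : Fin n → K => star (w j) :=
    measurable_star'.comp (measurable_pi_apply j)
  refine measurable_const.sub (Measurable.smul ?_ ((measurable_pi_apply i).mul h))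
  fun_prop

/-- A unitary matrix, depending measurably on the vector `v`, that maps `v` to a nonnegative
multiple of the first basis vector. After `v` has been multiplied from the right by a phase that
makes its first entry real, a reflection does this. -/
lemma exists_measurable_unitary_mulVec (n : ℕ) :
    ∃ V : (Fin n → K) → Matrix (Fin n) (Fin n) K, Measurable V ∧
      (∀ v, V v * (V v)ᴴ = 1) ∧ (∀ v, (V v)ᴴ * V v = 1) ∧
      ∀ v i, (V v *ᵥ v) i = if (i : ℕ) = 0 then √(∑ i, ‖v i‖ ^ 2) • (1 : K) else 0 := by
  rcases n with _ | n
  · exact ⟨fun _ => 1, measurable_const, by simp, by simp, fun v i => i.elim0⟩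
  -- `a v` is `v` with its phase removed, `b v` is the target of the reflection, and the diagonal
  -- matrix `D` cancels the phase that reappears in the first entry
  let N : (Fin (n + 1) → K) → ℝ := fun v => √(∑ i, ‖v i‖ ^ 2)
  let a : (Fin (n + 1) → K) → (Fin (n + 1) → K) := fun v i => v i * star (phase (v 0))
  let b : (Fin (n + 1) → K) → (Fin (n + 1) → K) := fun v i => if i = 0 then N v • 1 else 0
  let D : K → Matrix (Fin (n + 1)) (Fin (n + 1)) K := fun c =>
    diagonal fun i => if i = 0 then star (phase c) else 1
  have hN : ∀ v, N v ^ 2 = ∑ i, ‖v i‖ ^ 2 := fun v => Real.sq_sqrt (by positivity)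
  have hD1 : ∀ c, D c * (D c)ᴴ = 1 := by
    intro c
    simp only [D, diagonal_conjTranspose, diagonal_mul_diagonal]
    rw [← diagonal_one]
    congr 1
    ext i
    by_cases hi : i = 0 <;> simp [hi, star_phase_mul_phase]
  have hD2 : ∀ c, (D c)ᴴ * D c = 1 := by
    intro c
    simp only [D, diagonal_conjTranspose, diagonal_mul_diagonal]
    rw [← diagonal_one]
    congr 1
    ext i
    by_cases hi : i = 0 <;> simp [hi, phase_mul_star_phase]
  refine ⟨fun v => D (v 0) * householder (a v - b v), ?_, fun v => ?_, fun v => ?_, fun v i => ?_⟩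
  · have hs : Measurable fun v : Fin (n + 1) → K => star (phase (v 0)) :=
      measurable_star'.comp (measurable_phase.comp (measurable_pi_apply 0))
    refine Measurable.matrix_mul (measurable_matrix_iff.2 fun i j => ?_)
      (measurable_householder.comp (Measurable.sub (measurable_pi_iff.2 fun i => ?_)
        (measurable_pi_iff.2 fun i => ?_)))
    · by_cases hij : i = j
      · by_cases hj : j = 0 <;> simp [D, hij, hj, hs]
      · simp [D, hij]
    · exact (measurable_pi_apply i).mul hs
    · by_cases hi : i = 0
      · simp only [b, hi, if_true, N]
        fun_prop
      · simp [b, hi]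
  · rw [conjTranspose_mul, conjTranspose_householder, ← mul_assoc, mul_assoc (D _),
      householder_mul_self, mul_one, hD1]
  · rw [conjTranspose_mul, conjTranspose_householder, mul_assoc, ← mul_assoc _ (D _), hD2, one_mul,
      householder_mul_self]
  · have hva : v = MulOpposite.op (phase (v 0)) • a v := by
      ext i
      simp [a, mul_assoc, star_phase_mul_phase]
    have hsum : ∑ i, ‖a v i‖ ^ 2 = ∑ i, ‖b v i‖ ^ 2 := by
      simp only [a, b, norm_mul, norm_star', norm_phase, mul_one]
      rw [Fin.sum_univ_succ (fun i => ‖if i = 0 then N v • (1 : K) else 0‖ ^ 2)]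
      simp [norm_smul, hN]
    have hin : star (a v) ⬝ᵥ b v = (N v * ‖v 0‖) • (1 : K) := by
      simp only [dotProduct, Pi.star_apply, a, b]
      rw [Fin.sum_univ_succ]
      simp [mul_star_phase, smul_smul]
    rw [hva, mulVec_smul, ← hva, ← mulVec_mulVec, householder_sub_mulVec hsum hin]
    by_cases hi : i = 0
    · simp [D, mulVec_diagonal, b, hi, smul_mul_assoc, star_phase_mul_phase, N]
    · simp [D, mulVec_diagonal, b, hi]

end Householder

/-! ### Tridiagonalization of the chiral matrix -/

/-- The symmetric tridiagonal matrix with zero diagonal and off-diagonal entries `d`; the last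
entry of `d` does not occur. -/
def tridiag (N : ℕ) (d : Fin N → ℝ) : Matrix (Fin N) (Fin N) ℝ :=
  Matrix.of fun i j =>
    if (j : ℕ) = i + 1 then d i else if (i : ℕ) = j + 1 then d j else 0

/-- The law of the entry with number `k` (counted from `0`) on the off-diagonal of the Jacobi
matrix; the entries that are zero by definition have the law `δ₀`. -/
noncomputable def offDiagLaw (β : ℝ) (m n k : ℕ) : Measure ℝ :=
  if k % 2 = 0 then
    if k / 2 < min m n then chiMeasure (β * ((n : ℝ) - (k / 2 : ℕ))) else Measure.dirac 0
  else
    if k / 2 < min (m - 1) n then chiMeasure (β * ((m : ℝ) - ((k / 2 : ℕ) + 1)))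
    else Measure.dirac 0

lemma offDiagLaw_zero_left (β : ℝ) (n k : ℕ) : offDiagLaw β 0 n k = Measure.dirac 0 := by
  simp [offDiagLaw]

/-- Removing the first row of an `(m + 1) × n` matrix and transposing the rest shifts the
off-diagonal by one place. -/
lemma offDiagLaw_succ_succ (β : ℝ) (m n k : ℕ) :
    offDiagLaw β (m + 1) n (k + 1) = offDiagLaw β n m k := by
  unfold offDiagLaw
  rcases Nat.even_or_odd' k with ⟨c, rfl | rfl⟩
  · have h1 : (2 * c + 1) % 2 = 1 := by omega
    have h2 : (2 * c + 1) / 2 = c := by omega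
    have h3 : 2 * c % 2 = 0 := by omega
    have h4 : 2 * c / 2 = c := by omega
    simp only [h1, h2, h3, h4, one_ne_zero, if_false, if_true, Nat.add_sub_cancel, min_comm n m]
    push_cast
    ring_nf
  · have h1 : (2 * c + 1 + 1) % 2 = 0 := by omega
    have h2 : (2 * c + 1 + 1) / 2 = c + 1 := by omega
    have h3 : (2 * c + 1) % 2 = 1 := by omega
    have h4 : (2 * c + 1) / 2 = c := by omega
    have h5 : c + 1 < min (m + 1) n ↔ c < min (n - 1) m := by omega
    simp only [h1, h2, h3, h4, h5, one_ne_zero, if_false, if_true]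
    push_cast
    rfl

section Step

variable {K : Type*} [NormedDivisionRing K] {m n N : ℕ}

/-- The rows of `X` other than the first one. -/
def tailRows (X : Matrix (Fin (m + 1)) (Fin n) K) : Matrix (Fin m) (Fin n) K :=
  Matrix.of fun i j => X i.succ j

/-- The index set of the chiral matrix, with the first row split off and the two remaining blocks
exchanged. -/
def splitFirst (m n : ℕ) : Fin (m + 1) ⊕ Fin n ≃ Unit ⊕ (Fin n ⊕ Fin m) where
  toFun := Sum.elim (Fin.cases (Sum.inl ()) fun i => Sum.inr (Sum.inr i))
    fun j => Sum.inr (Sum.inl j)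
  invFun := Sum.elim (fun _ => Sum.inl 0) (Sum.elim Sum.inr fun i => Sum.inl i.succ)
  left_inv := by
    rintro (i | j)
    · induction i using Fin.cases <;> rfl
    · rfl
  right_inv := by
    rintro (i | j | i) <;> rfl

/-- The index set `Fin (N + 1)` with the first element split off. -/
def splitZero (N : ℕ) : Fin (N + 1) ≃ Unit ⊕ Fin N where
  toFun := Fin.cases (Sum.inl ()) Sum.inr
  invFun := Sum.elim (fun _ => 0) Fin.succ
  left_inv i := by induction i using Fin.cases <;> rfl
  right_inv := by rintro (i | j) <;> rfl

/-- The block diagonal matrix with blocks `V` and the identity of size `m`. -/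
def extendByOne (m : ℕ) (V : Matrix (Fin n) (Fin n) K) :
    Matrix (Fin n ⊕ Fin m) (Fin n ⊕ Fin m) K :=
  fromBlocks V 0 0 1

/-- One step of the tridiagonalization: the unitary matrix for `X` in terms of the one for the
smaller matrix, `V` being the unitary that rotates the first row of `X`. -/
def stepUnitary (V : Matrix (Fin n) (Fin n) K) (U : Matrix (Fin N) (Fin n ⊕ Fin m) K) :
    Matrix (Fin (N + 1)) (Fin (m + 1) ⊕ Fin n) K :=
  (fromBlocks (1 : Matrix Unit Unit K) 0 0 (U * extendByOne m V)).submatrix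
    (splitZero N) (splitFirst m n)

/-- The matrix `U` maps the first basis vector of the first block to the first basis vector.
There is no condition if the first block is empty. -/
def FixesFirst (U : Matrix (Fin N) (Fin m ⊕ Fin n) K) : Prop :=
  ∀ i (l : Fin m), (l : ℕ) = 0 → U i (Sum.inl l) = if (i : ℕ) = 0 then 1 else 0

lemma fixesFirst_stepUnitary (V : Matrix (Fin n) (Fin n) K)
    (U : Matrix (Fin N) (Fin n ⊕ Fin m) K) : FixesFirst (stepUnitary V U) := by
  intro i l hl
  obtain rfl : l = 0 := Fin.ext hl
  induction i using Fin.cases <;> simp [stepUnitary, splitZero, splitFirst]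

lemma tridiag_cons [InnerProductSpace ℝ K] (s : ℝ) (d : Fin N → ℝ) :
    (tridiag (N + 1) (Fin.cons s d)).map (fun r => r • (1 : K)) =
      (fromBlocks (0 : Matrix Unit Unit K)
        (Matrix.of fun _ (j : Fin N) => if (j : ℕ) = 0 then s • (1 : K) else 0)
        (Matrix.of fun (i : Fin N) _ => if (i : ℕ) = 0 then s • (1 : K) else 0)
        ((tridiag N d).map fun r => r • (1 : K))).submatrix (splitZero N) (splitZero N) := by
  ext i j
  induction i using Fin.cases <;> induction j using Fin.cases <;>
    simp [splitZero, tridiag, ite_smul]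

variable [StarRing K]

lemma extendByOne_mul_conjTranspose (m : ℕ) {V : Matrix (Fin n) (Fin n) K} (hV : V * Vᴴ = 1) :
    extendByOne m V * (extendByOne m V)ᴴ = 1 := by
  simp [extendByOne, fromBlocks_conjTranspose, fromBlocks_multiply, hV]

lemma conjTranspose_mul_extendByOne (m : ℕ) {V : Matrix (Fin n) (Fin n) K} (hV : Vᴴ * V = 1) :
    (extendByOne m V)ᴴ * extendByOne m V = 1 := by
  simp [extendByOne, fromBlocks_conjTranspose, fromBlocks_multiply, hV]

/-- Conjugating the chiral matrix by `V ⊕ 1`. -/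
lemma extendByOne_conj {V : Matrix (Fin n) (Fin n) K} (A : Matrix (Fin n) (Fin n) K)
    (Y : Matrix (Fin n) (Fin m) K) :
    extendByOne m V * fromBlocks A Y Yᴴ 0 * (extendByOne m V)ᴴ =
      fromBlocks (V * A * Vᴴ) (V * Y) (V * Y)ᴴ 0 := by
  simp [extendByOne, fromBlocks_conjTranspose, fromBlocks_multiply]

lemma stepUnitary_mul_conjTranspose {V : Matrix (Fin n) (Fin n) K}
    {U : Matrix (Fin N) (Fin n ⊕ Fin m) K} (hV : V * Vᴴ = 1) (hU : U * Uᴴ = 1) :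
    stepUnitary V U * (stepUnitary V U)ᴴ = 1 := by
  have h : U * extendByOne m V * (U * extendByOne m V)ᴴ = 1 := by
    rw [conjTranspose_mul, Matrix.mul_assoc U, ← Matrix.mul_assoc (extendByOne m V),
      extendByOne_mul_conjTranspose m hV, Matrix.one_mul, hU]
  rw [stepUnitary, conjTranspose_submatrix, submatrix_mul_equiv, fromBlocks_conjTranspose,
    fromBlocks_multiply, h]
  simp

lemma conjTranspose_mul_stepUnitary {V : Matrix (Fin n) (Fin n) K}
    {U : Matrix (Fin N) (Fin n ⊕ Fin m) K} (hV : Vᴴ * V = 1) (hU : Uᴴ * U = 1) :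
    (stepUnitary V U)ᴴ * stepUnitary V U = 1 := by
  have h : (U * extendByOne m V)ᴴ * (U * extendByOne m V) = 1 := by
    rw [conjTranspose_mul, Matrix.mul_assoc _ Uᴴ, ← Matrix.mul_assoc Uᴴ, hU, Matrix.one_mul,
      conjTranspose_mul_extendByOne m hV]
  rw [stepUnitary, conjTranspose_submatrix, submatrix_mul_equiv, fromBlocks_conjTranspose,
    fromBlocks_multiply, h]
  simp

lemma fromBlocks_chiral_eq_submatrix (X : Matrix (Fin (m + 1)) (Fin n) K) :
    fromBlocks 0 X Xᴴ 0 = (fromBlocks (0 : Matrix Unit Unit K)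
      (fromCols (replicateRow Unit (X 0)) 0) (fromRows (replicateCol Unit (star (X 0))) 0)
      (fromBlocks 0 (tailRows X)ᴴ (tailRows X) 0)).submatrix (splitFirst m n) (splitFirst m n) := by
  ext (i | i) (j | j)
  · induction i using Fin.cases <;> induction j using Fin.cases <;> simp [splitFirst]
  · induction i using Fin.cases <;> simp [splitFirst, tailRows]
  · induction j using Fin.cases <;> simp [splitFirst, tailRows]
  · simp [splitFirst]

variable [InnerProductSpace ℝ K] [IsStarNormedAlgebra K]

/-- One step of the tridiagonalization. As `U` fixes the first basis vector, the coupling of the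
first row to the rest stays at the first place. -/
lemma stepUnitary_conj (X : Matrix (Fin (m + 1)) (Fin n) K) {V : Matrix (Fin n) (Fin n) K}
    {U : Matrix (Fin N) (Fin n ⊕ Fin m) K} {s : ℝ} {d : Fin N → ℝ}
    (hV : ∀ j, (V *ᵥ star (X 0)) j = if (j : ℕ) = 0 then s • (1 : K) else 0)
    (hs : n = 0 → s = 0) (hU1 : FixesFirst U)
    (hU : U * fromBlocks 0 (V * (tailRows X)ᴴ) (V * (tailRows X)ᴴ)ᴴ 0 * Uᴴ =
      (tridiag N d).map fun r => r • (1 : K)) :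
    stepUnitary V U * fromBlocks 0 X Xᴴ 0 * (stepUnitary V U)ᴴ =
      (tridiag (N + 1) (Fin.cons s d)).map fun r => r • (1 : K) := by
  have hcol : U * extendByOne m V *
      (fromRows (replicateCol Unit (star (X 0))) 0 : Matrix (Fin n ⊕ Fin m) Unit K) =
      Matrix.of fun (i : Fin N) (_ : Unit) => if (i : ℕ) = 0 then s • (1 : K) else 0 := by
    have h : extendByOne m V *
        (fromRows (replicateCol Unit (star (X 0))) 0 : Matrix (Fin n ⊕ Fin m) Unit K) =
        fromRows (Matrix.of fun (j : Fin n) (_ : Unit) =>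
          if (j : ℕ) = 0 then s • (1 : K) else 0) 0 := by
      rw [extendByOne, fromBlocks_mul_fromRows, Matrix.mul_zero, Matrix.zero_mul, Matrix.mul_zero,
        add_zero, add_zero]
      congr 1
      ext j u
      exact hV j
    rw [Matrix.mul_assoc, h]
    ext i u
    rw [mul_apply, Fintype.sum_sum_type]
    rcases n with _ | n
    · simp [hs rfl]
    · rw [Fin.sum_univ_succ]
      by_cases hi : (i : ℕ) = 0 <;> simp [hU1 i 0 rfl, hi]
  have hrow : (fromCols (replicateRow Unit (X 0)) 0 : Matrix Unit (Fin n ⊕ Fin m) K) *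
      (U * extendByOne m V)ᴴ =
      Matrix.of fun (_ : Unit) (i : Fin N) => if (i : ℕ) = 0 then s • (1 : K) else 0 := by
    have h := congrArg conjTranspose hcol
    rw [conjTranspose_mul, conjTranspose_fromRows_eq_fromCols_conjTranspose,
      conjTranspose_replicateCol, star_star, conjTranspose_zero] at h
    rw [h]
    ext u i
    by_cases hi : (i : ℕ) = 0 <;> simp [hi]
  have hdiag : U * extendByOne m V * fromBlocks 0 (tailRows X)ᴴ (tailRows X) 0 *
      (U * extendByOne m V)ᴴ = (tridiag N d).map fun r => r • (1 : K) := by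
    have h := extendByOne_conj (V := V) 0 (tailRows X)ᴴ
    rw [conjTranspose_conjTranspose, Matrix.mul_zero, Matrix.zero_mul] at h
    rw [← hU, ← h, conjTranspose_mul]
    simp only [Matrix.mul_assoc]
  rw [fromBlocks_chiral_eq_submatrix, tridiag_cons, stepUnitary, conjTranspose_submatrix,
    submatrix_mul_equiv, submatrix_mul_equiv, fromBlocks_conjTranspose, fromBlocks_multiply,
    fromBlocks_multiply]
  simp only [conjTranspose_one, conjTranspose_zero, Matrix.mul_one, Matrix.mul_zero, Matrix.zero_mul,
    add_zero, zero_add, Matrix.one_mul, hcol, hrow, hdiag]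

end Step

lemma measurable_extendByOne {α K : Type*} [NormedDivisionRing K] [MeasurableSpace K]
    [MeasurableSpace α] (m : ℕ) {n : ℕ} {V : α → Matrix (Fin n) (Fin n) K} (hV : Measurable V) :
    Measurable fun a => extendByOne m (V a) := by
  refine measurable_matrix_iff.2 ?_
  rintro (i | i) (j | j)
  · exact hV.matrix_apply i j
  all_goals exact measurable_const

section Tridiagonalization

variable {K : Type*} [NormedDivisionRing K] [InnerProductSpace ℝ K] [FiniteDimensional ℝ K]
  [MeasurableSpace K] [BorelSpace K]

lemma measurable_stepUnitary {α : Type*} [MeasurableSpace α] {m n N : ℕ}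
    {V : α → Matrix (Fin n) (Fin n) K} {U : α → Matrix (Fin N) (Fin n ⊕ Fin m) K}
    (hV : Measurable V) (hU : Measurable U) :
    Measurable fun a => stepUnitary (V a) (U a) := by
  have h2 := hU.matrix_mul (measurable_extendByOne m hV)
  have h3 : Measurable fun a => fromBlocks (1 : Matrix Unit Unit K) 0 0
      (U a * extendByOne m (V a)) := by
    refine measurable_matrix_iff.2 ?_
    rintro (i | i) (j | j)
    · exact measurable_const
    · exact measurable_const
    · exact measurable_const
    · exact h2.matrix_apply i j
  exact measurable_matrix_iff.2 fun i j => h3.matrix_apply _ _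

lemma map_sqrt_sum_gaussRow (m n : ℕ) :
    (gaussRow K n).map (fun r => √(∑ i, ‖r i‖ ^ 2)) =
      offDiagLaw (Module.finrank ℝ K) (m + 1) n 0 := by
  rcases Nat.eq_zero_or_pos n with rfl | hn
  · simp [offDiagLaw]
  · rw [gaussRow, map_sqrt_sum_pi_stdGaussian hn Module.finrank_pos]
    simp [offDiagLaw, hn]

variable (K) in
lemma isProbabilityMeasure_offDiagLaw (m n k : ℕ) :
    IsProbabilityMeasure (offDiagLaw (Module.finrank ℝ K) m n k) := by
  induction k generalizing m n with
  | zero =>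
    rcases m with _ | m
    · rw [offDiagLaw_zero_left]; infer_instance
    · rw [← map_sqrt_sum_gaussRow]
      exact Measure.isProbabilityMeasure_map (Measurable.aemeasurable (by fun_prop))
  | succ k ih =>
    rcases m with _ | m
    · rw [offDiagLaw_zero_left]; infer_instance
    · rw [offDiagLaw_succ_succ]; exact ih n m

variable [StarRing K]

/-- A chiral matrix without rows is zero, and so is its off-diagonal. -/
lemma exists_tridiagonalization_zero (N n : ℕ) (h : N = n) :
    ∃ (d : Matrix (Fin 0) (Fin n) K → Fin N → ℝ)
      (U : Matrix (Fin 0) (Fin n) K → Matrix (Fin N) (Fin 0 ⊕ Fin n) K),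
      MeasurePreserving d (gaussMat K 0 n)
        (Measure.pi fun k : Fin N => offDiagLaw (Module.finrank ℝ K) 0 n k) ∧
      Measurable U ∧ (∀ X, U X * (U X)ᴴ = 1) ∧ (∀ X, (U X)ᴴ * U X = 1) ∧
      (∀ X, FixesFirst (U X)) ∧
      ∀ X, U X * fromBlocks 0 X Xᴴ 0 * (U X)ᴴ = (tridiag N (d X)).map fun r => r • (1 : K) := by
  subst h
  let e : Fin N ≃ Fin 0 ⊕ Fin N := (Equiv.emptySum (Fin 0) (Fin N)).symm
  refine ⟨fun _ => 0, fun _ => (1 : Matrix (Fin 0 ⊕ Fin N) (Fin 0 ⊕ Fin N) K).submatrix e id,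
    ⟨measurable_const, ?_⟩, measurable_const, fun X => ?_, fun X => ?_, fun X i l => l.elim0,
    fun X => ?_⟩
  · simp only [offDiagLaw_zero_left, Measure.map_const, measure_univ, one_smul]
    refine (Measure.pi_eq fun s hs => ?_).symm
    rw [Measure.dirac_apply' _ (MeasurableSet.univ_pi hs)]
    classical
    simp only [Measure.dirac_apply' _ (hs _), Set.indicator_apply, Set.mem_univ_pi,
      Pi.zero_apply, Pi.one_apply]
    rw [Finset.prod_ite_zero]
    simp
  · ext i j
    simp [Matrix.mul_apply, Matrix.one_apply]
  · ext i j
    simp [Matrix.mul_apply, Matrix.one_apply, ← Equiv.eq_symm_apply]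
  · have h0 : fromBlocks 0 X Xᴴ 0 = (0 : Matrix (Fin 0 ⊕ Fin N) (Fin 0 ⊕ Fin N) K) := by
      ext (i | i) (j | j)
      · exact i.elim0
      · exact i.elim0
      · exact j.elim0
      · rfl
    rw [h0]
    ext i j
    simp [tridiag]

variable [IsStarNormedAlgebra K]

/-- The tridiagonalization of the chiral matrix built from `X`, with the law of the off-diagonal
for a Gaussian `X`. The induction removes the first row `r` of `X`: a unitary `V` with
`V r* = ‖r‖ e₁` replaces the other rows `Y` by the `n × m` matrix `V Y*`, which is again Gaussian
and is independent of `‖r‖`. The size `N` is kept apart from `m + n` because `(m + 1) + n` and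
`(n + m) + 1` are different terms. -/
lemma exists_tridiagonalization (N : ℕ) : ∀ m n : ℕ, N = m + n →
    ∃ (d : Matrix (Fin m) (Fin n) K → Fin N → ℝ)
      (U : Matrix (Fin m) (Fin n) K → Matrix (Fin N) (Fin m ⊕ Fin n) K),
      MeasurePreserving d (gaussMat K m n)
        (Measure.pi fun k : Fin N => offDiagLaw (Module.finrank ℝ K) m n k) ∧
      Measurable U ∧ (∀ X, U X * (U X)ᴴ = 1) ∧ (∀ X, (U X)ᴴ * U X = 1) ∧
      (∀ X, FixesFirst (U X)) ∧
      ∀ X, U X * fromBlocks 0 X Xᴴ 0 * (U X)ᴴ = (tridiag N (d X)).map fun r => r • (1 : K) := by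
  induction N with
  | zero =>
    rintro (_ | m) n h
    · exact exists_tridiagonalization_zero 0 n (by omega)
    · omega
  | succ N ih =>
    rintro (_ | m) n h
    · exact exists_tridiagonalization_zero (N + 1) n (by omega)
    · obtain ⟨d, U, hd, hUm, hU1, hU2, hU3, hU4⟩ := ih n m (by omega)
      obtain ⟨V, hVm, hV1, hV2, hV3⟩ := exists_measurable_unitary_mulVec (K := K) n
      have hsm : Measurable fun r : Fin n → K => V (star r) :=
        hVm.comp (measurable_pi_iff.2 fun i => measurable_star'.comp (measurable_pi_apply i))
      have htail : Measurable fun X : Matrix (Fin (m + 1)) (Fin n) K => tailRows X :=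
        measurable_matrix_iff.2 fun i j => measurable_id.matrix_apply i.succ j
      have hrow : Measurable fun X : Matrix (Fin (m + 1)) (Fin n) K => X 0 :=
        measurable_pi_apply (0 : Fin (m + 1))
      have hZ : Measurable fun X : Matrix (Fin (m + 1)) (Fin n) K =>
          V (star (X 0)) * (tailRows X)ᴴ :=
        (hsm.comp hrow).matrix_mul htail.matrix_conjTranspose
      refine ⟨fun X => Fin.cons (√(∑ i, ‖X 0 i‖ ^ 2)) (d (V (star (X 0)) * (tailRows X)ᴴ)),
        fun X => stepUnitary (V (star (X 0))) (U (V (star (X 0)) * (tailRows X)ᴴ)),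
        ?_, ?_, fun X => ?_, fun X => ?_, fun X => ?_, fun X => ?_⟩
      · have hprob := isProbabilityMeasure_offDiagLaw K (m + 1) n
        have h1 := measurePreserving_firstRow (K := K) m n
        have hf : MeasurePreserving (fun r : Fin n → K => √(∑ i, ‖r i‖ ^ 2)) (gaussRow K n)
            (offDiagLaw (Module.finrank ℝ K) (m + 1) n 0) :=
          ⟨by fun_prop, map_sqrt_sum_gaussRow m n⟩
        have h2 := hf.skew_product (g := fun r Y => d (V (star r) * Yᴴ))
          (μc := gaussMat K m n)
          (μd := Measure.pi fun k : Fin N => offDiagLaw (Module.finrank ℝ K) n m k)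
          (hd.measurable.comp ((hsm.comp measurable_fst).matrix_mul
            measurable_snd.matrix_conjTranspose))
          (Filter.Eventually.of_forall fun r => (hd.comp
            ((measurePreserving_mul_left m (hV1 (star r)) (hV2 (star r))).comp
              (measurePreserving_conjTranspose m n))).map_eq)
        have h3 := (measurePreserving_piFinSuccAbove (fun k : Fin (N + 1) =>
          offDiagLaw (Module.finrank ℝ K) (m + 1) n k) 0).symm
        have h4 : (fun j : Fin N => offDiagLaw (Module.finrank ℝ K) (m + 1) n
            ((0 : Fin (N + 1)).succAbove j : ℕ)) =
            fun k : Fin N => offDiagLaw (Module.finrank ℝ K) n m k := by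
          ext1 k
          simp [offDiagLaw_succ_succ]
        rw [h4] at h3
        have h5 := h3.comp (h2.comp h1)
        convert h5 using 1
        ext1 X
        exact (Fin.insertNth_zero' _ _).symm
      · exact measurable_stepUnitary (hsm.comp hrow) (hUm.comp hZ)
      · exact stepUnitary_mul_conjTranspose (hV1 _) (hU1 _)
      · exact conjTranspose_mul_stepUnitary (hV2 _) (hU2 _)
      · exact fixesFirst_stepUnitary _ _
      · refine stepUnitary_conj X (fun j => ?_) ?_ (hU3 _) (hU4 _)
        · rw [hV3]
          simp [norm_star']
        · rintro rfl
          simp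

end Tridiagonalization

/-! ### Nonnegative matrices of rank one -/

lemma exists_eq_mul_of_colRank_eq_one {ι κ K : Type*} [DivisionRing K] {A : Matrix ι κ K}
    (hA : colRank A = 1) : A ≠ 0 ∧ ∃ (s : ι → K) (p : κ → K), ∀ i j, A i j = s i * p j := by
  constructor
  · rintro rfl
    have h : Submodule.span Kᵐᵒᵖ (Set.range (0 : Matrix ι κ K).col) = ⊥ := by
      rw [Submodule.span_eq_bot]
      rintro _ ⟨j, rfl⟩
      rfl
    rw [colRank, h, finrank_bot] at hA
    exact zero_ne_one hA
  · obtain ⟨v, -, hv⟩ := finrank_eq_one_iff'.1 hA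
    choose p hp using fun j => hv ⟨A.col j, Submodule.subset_span ⟨j, rfl⟩⟩
    refine ⟨v.1, fun j => (p j).unop, fun i j => ?_⟩
    have h := congrFun (congrArg Subtype.val (hp j)) i
    exact h.symm

/-- The `m × m` matrix with upper left entry `a` and zeros elsewhere. -/
def cornerEntry {K : Type*} [Zero K] (m : ℕ) (a : K) : Matrix (Fin m) (Fin m) K :=
  Matrix.of fun i j => if (i : ℕ) = 0 ∧ (j : ℕ) = 0 then a else 0

section RankOne

variable {K : Type*} [NormedDivisionRing K] {m : ℕ}

/-- A column of the matrix with nonzero diagonal entry can be chosen measurably. -/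
lemma exists_measurable_column [MeasurableSpace K] [BorelSpace K] (m : ℕ) :
    ∃ c : Matrix (Fin m) (Fin m) K → Fin m → K, Measurable c ∧
      ∀ Γ, (∃ k, Γ k k ≠ 0) → ∃ k, Γ k k ≠ 0 ∧ c Γ = fun i => Γ i k := by
  classical
  suffices h : ∀ s : Finset (Fin m), ∃ c : Matrix (Fin m) (Fin m) K → Fin m → K, Measurable c ∧
      ∀ Γ, (∃ k ∈ s, Γ k k ≠ 0) → ∃ k, Γ k k ≠ 0 ∧ c Γ = fun i => Γ i k by
    simpa using h Finset.univ
  intro s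
  induction s using Finset.induction_on with
  | empty => exact ⟨0, measurable_const, by simp⟩
  | insert k s _ ih =>
    obtain ⟨c, hc, hcs⟩ := ih
    refine ⟨fun Γ => if Γ k k ≠ 0 then fun i => Γ i k else c Γ, ?_, fun Γ hΓ => ?_⟩
    · refine Measurable.ite ?_ (measurable_pi_iff.2 fun i => measurable_id.matrix_apply i k) hc
      exact (measurable_id.matrix_apply k k) (measurableSet_singleton (0 : K)).compl
    · by_cases hk : Γ k k ≠ 0
      · exact ⟨k, hk, if_pos hk⟩
      · simp only [if_neg hk]
        obtain ⟨j, hj, hj0⟩ := hΓ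
        rcases Finset.mem_insert.1 hj with rfl | hjs
        · exact absurd hj0 hk
        · exact hcs Γ ⟨j, hjs, hj0⟩

variable [InnerProductSpace ℝ K] [StarRing K] [IsStarNormedAlgebra K]

/-- A Hermitian matrix of rank one with nonnegative diagonal is a nonnegative multiple of `c c*`
for each of its columns `c` through a nonzero diagonal entry, and there is such a column. -/
lemma rank_one_eq_smul_vecMulVec {Γ : Matrix (Fin m) (Fin m) K} (hH : Γ.IsHermitian)
    (hd : ∀ i, ∃ r : ℝ, 0 ≤ r ∧ Γ i i = r • (1 : K)) (hr : colRank Γ = 1) :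
    (∃ k, Γ k k ≠ 0) ∧ ∀ k, Γ k k ≠ 0 → ∃ t : ℝ, 0 ≤ t ∧
      Γ = t • vecMulVec (fun i => Γ i k) (star fun i => Γ i k) := by
  obtain ⟨h0, s, p, hsp⟩ := exists_eq_mul_of_colRank_eq_one hr
  constructor
  · by_contra! hall
    refine h0 (ext fun i j => ?_)
    by_contra hij
    have hji : Γ j i ≠ 0 := by
      rw [← hH.apply]
      simpa using hij
    rw [Matrix.zero_apply, hsp, mul_eq_zero, not_or] at hij
    rw [hsp, mul_ne_zero_iff] at hji
    exact mul_ne_zero hij.1 hji.2 ((hsp i i).symm.trans (hall i))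
  · intro k hk
    obtain ⟨r, hr0, hrk⟩ := hd k
    have hrne : r ≠ 0 := by
      rintro rfl
      simp [hrk] at hk
    refine ⟨r⁻¹, inv_nonneg.2 hr0, ext fun i j => ?_⟩
    have hmul : Γ i k * Γ k j = r • Γ i j := by
      have h : p k * s k = r • (1 : K) := by
        -- `s k * p k` is central, so it commutes with the invertible element `s k`
        have h1 : s k * p k = r • (1 : K) := (hsp k k).symm.trans hrk
        have hs : s k ≠ 0 := by
          intro h
          rw [hsp, h, zero_mul] at hk
          exact hk rfl
        apply mul_left_cancel₀ hs
        rw [← mul_assoc, h1, smul_mul_assoc, one_mul, mul_smul_comm, mul_one]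
      rw [hsp i k, hsp k j, hsp i j, mul_assoc, ← mul_assoc (p k), h, smul_mul_assoc, one_mul,
        mul_smul_comm]
    rw [Matrix.smul_apply, vecMulVec_apply, Pi.star_apply, hH.apply, hmul, smul_smul,
      inv_mul_cancel₀ hrne, one_smul]

/-- A unitary that maps the column `c` to `‖c‖ e₁` brings `t c c*` to its Hilbert-Schmidt norm times
the corner matrix. -/
lemma rank_one_conj {Γ V : Matrix (Fin m) (Fin m) K} {c : Fin m → K} {t : ℝ} (ht : 0 ≤ t)
    (hΓ : Γ = t • vecMulVec c (star c))
    (hV : ∀ i, (V *ᵥ c) i = if (i : ℕ) = 0 then √(∑ i, ‖c i‖ ^ 2) • (1 : K) else 0) :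
    V * Γ * Vᴴ = cornerEntry m (hsNorm Γ • (1 : K)) := by
  have hq : 0 ≤ ∑ i, ‖c i‖ ^ 2 := by positivity
  have hnorm : hsNorm Γ = t * ∑ i, ‖c i‖ ^ 2 := by
    have h : ∑ i, ∑ j, ‖Γ i j‖ ^ 2 = (t * ∑ i, ‖c i‖ ^ 2) ^ 2 := by
      simp only [hΓ, Matrix.smul_apply, vecMulVec_apply, Pi.star_apply, norm_smul, norm_mul,
        norm_star', Real.norm_eq_abs, mul_pow, sq_abs]
      rw [sq (∑ i, ‖c i‖ ^ 2), Finset.sum_mul_sum]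
      simp only [Finset.mul_sum]
    rw [hsNorm, h, Real.sqrt_sq (by positivity)]
  have h1 : V * Γ * Vᴴ = t • vecMulVec (V *ᵥ c) (star (V *ᵥ c)) := by
    rw [hΓ, mul_smul_comm, mul_vecMulVec, smul_mul_assoc, vecMulVec_mul, star_mulVec]
  rw [h1, hnorm]
  ext i j
  rw [Matrix.smul_apply, vecMulVec_apply, Pi.star_apply, hV, hV, cornerEntry, of_apply]
  by_cases hi : (i : ℕ) = 0 <;> by_cases hj : (j : ℕ) = 0
  · simp only [hi, hj, if_true, star_smul, star_trivial, star_one, smul_mul_smul_comm,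
      Real.mul_self_sqrt hq, one_mul, smul_smul, and_self]
  all_goals simp [hi, hj]

/-- A matrix that fixes the first basis vector does not change the corner matrix. -/
lemma fixesFirst_conj_corner {n N : ℕ} {U : Matrix (Fin N) (Fin m ⊕ Fin n) K}
    (hU : FixesFirst U) (hm : 0 < m) (l : ℝ) :
    U * (fromBlocks (cornerEntry m (l • (1 : K))) 0 0 0 :
      Matrix (Fin m ⊕ Fin n) (Fin m ⊕ Fin n) K) * Uᴴ =
      (l • corner N).map fun r => r • (1 : K) := by
  obtain ⟨m, rfl⟩ := Nat.exists_eq_succ_of_ne_zero hm.ne'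
  let e : Fin (m + 1) ⊕ Fin n → K := Sum.elim (fun i => if (i : ℕ) = 0 then 1 else 0) 0
  have he : U *ᵥ e = fun i : Fin N => if (i : ℕ) = 0 then (1 : K) else 0 := by
    ext i
    rw [mulVec, dotProduct, Fintype.sum_sum_type, Fin.sum_univ_succ]
    simp [e, hU i 0 rfl]
  have hA : fromBlocks (cornerEntry (m + 1) (l • (1 : K))) 0 0 0 =
      l • vecMulVec e (star e) := by
    ext (i | i) (j | j)
    · rw [fromBlocks_apply₁₁, cornerEntry, of_apply, Matrix.smul_apply, vecMulVec_apply, Pi.star_apply]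
      by_cases hi : (i : ℕ) = 0 <;> by_cases hj : (j : ℕ) = 0 <;>
        simp only [e, hi, hj, Sum.elim_inl, if_true, if_false, and_self, and_false, false_and,
          star_one, star_zero, mul_one, mul_zero, smul_zero]
    all_goals simp [e, vecMulVec_apply]
  rw [hA, Matrix.mul_smul, mul_vecMulVec, Matrix.smul_mul, vecMulVec_mul, ← star_mulVec, he]
  ext i j
  rw [Matrix.smul_apply, vecMulVec_apply, Pi.star_apply, map_apply, Matrix.smul_apply, corner,
    of_apply]
  by_cases hi : (i : ℕ) = 0 <;> by_cases hj : (j : ℕ) = 0 <;> simp [hi, hj]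

end RankOne

/-! ### The spiked chiral matrix -/

/-- The place on the off-diagonal, counted from `0`, of each of the `x` (even places) and the `y`
(odd places). -/
def offDiagIndex (m n : ℕ) : Fin (min m n) ⊕ Fin (min (m - 1) n) → Fin (m + n) :=
  Sum.elim (fun j => ⟨2 * j, by omega⟩) (fun j => ⟨2 * j + 1, by omega⟩)

lemma offDiagIndex_injective (m n : ℕ) : Function.Injective (offDiagIndex m n) := by
  rintro (i | i) (j | j) h <;> simp only [offDiagIndex, Sum.elim_inl, Sum.elim_inr, Fin.mk.injEq,
    Sum.inl.injEq, Sum.inr.injEq, reduceCtorEq] at h ⊢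
  · exact Fin.ext (by omega)
  · omega
  · omega
  · exact Fin.ext (by omega)

lemma jacobi_eq_tridiag {m n : ℕ} {d : Fin (m + n) → ℝ}
    (hd : ∀ k, k ∉ Set.range (offDiagIndex m n) → d k = 0) :
    jacobi m n (fun j => d (offDiagIndex m n (Sum.inl j)))
      (fun j => d (offDiagIndex m n (Sum.inr j))) = tridiag (m + n) d := by
  have h : ∀ k : Fin (m + n), offDiag m n (fun j => d (offDiagIndex m n (Sum.inl j)))
      (fun j => d (offDiagIndex m n (Sum.inr j))) k = d k := by
    intro k
    unfold offDiag
    split_ifs with h1 h2 h2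
    · refine congrArg d (Fin.ext ?_)
      simp only [offDiagIndex, Sum.elim_inl]
      omega
    · refine (hd k ?_).symm
      rintro ⟨j | j, hj⟩ <;> have := congrArg Fin.val hj <;>
        simp only [offDiagIndex, Sum.elim_inl, Sum.elim_inr] at this <;> omega
    · refine congrArg d (Fin.ext ?_)
      simp only [offDiagIndex, Sum.elim_inr]
      omega
    · refine (hd k ?_).symm
      rintro ⟨j | j, hj⟩ <;> have := congrArg Fin.val hj <;>
        simp only [offDiagIndex, Sum.elim_inl, Sum.elim_inr] at this <;> omega
  ext i j
  simp only [jacobi, tridiag, of_apply, h]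

lemma offDiagLaw_inl (β : ℝ) (m n : ℕ) (j : Fin (min m n)) :
    offDiagLaw β m n (offDiagIndex m n (Sum.inl j)) = chiMeasure (β * ((n : ℝ) - (j : ℕ))) := by
  have h1 : 2 * (j : ℕ) % 2 = 0 := by omega
  have h2 : 2 * (j : ℕ) / 2 = j := by omega
  simp only [offDiagLaw, offDiagIndex, Sum.elim_inl, h1, h2, if_true, j.2]

lemma offDiagLaw_inr (β : ℝ) (m n : ℕ) (j : Fin (min (m - 1) n)) :
    offDiagLaw β m n (offDiagIndex m n (Sum.inr j)) =
      chiMeasure (β * ((m : ℝ) - ((j : ℕ) + 1))) := by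
  have h1 : (2 * (j : ℕ) + 1) % 2 = 1 := by omega
  have h2 : (2 * (j : ℕ) + 1) / 2 = j := by omega
  simp only [offDiagLaw, offDiagIndex, Sum.elim_inr, h1, h2, one_ne_zero, if_false, if_true, j.2]

lemma offDiagLaw_of_notMem_range (β : ℝ) {m n : ℕ} {k : Fin (m + n)}
    (hk : k ∉ Set.range (offDiagIndex m n)) : offDiagLaw β m n k = Measure.dirac 0 := by
  unfold offDiagLaw
  split_ifs with h1 h2 h2
  · exact absurd ⟨Sum.inl ⟨k / 2, h2⟩, Fin.ext (by simp only [offDiagIndex, Sum.elim_inl]; omega)⟩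
      hk
  · rfl
  · exact absurd ⟨Sum.inr ⟨k / 2, h2⟩, Fin.ext (by simp only [offDiagIndex, Sum.elim_inr]; omega)⟩
      hk
  · rfl

lemma measurable_jacobi {α : Type*} [MeasurableSpace α] {m n : ℕ}
    {x : Fin (min m n) → α → ℝ} {y : Fin (min (m - 1) n) → α → ℝ}
    (hx : ∀ j, Measurable (x j)) (hy : ∀ j, Measurable (y j)) :
    Measurable fun a => jacobi m n (x · a) (y · a) := by
  have h : ∀ k, Measurable fun a => offDiag m n (x · a) (y · a) k := by
    intro k
    unfold offDiag
    split_ifs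
    exacts [hx _, measurable_const, hy _, measurable_const]
  refine measurable_matrix_iff.2 fun i j => ?_
  simp only [jacobi, of_apply]
  split_ifs
  exacts [h _, h _, measurable_const]

section General

variable {K : Type*} [NormedDivisionRing K] [InnerProductSpace ℝ K] [FiniteDimensional ℝ K]
  [MeasurableSpace K] [BorelSpace K] [StarRing K] [IsStarNormedAlgebra K]
  {Ω : Type*} [MeasurableSpace Ω] {P : Measure Ω} [IsProbabilityMeasure P] {m n : ℕ}

/-- Multiplying a Gaussian matrix by a unitary matrix that depends on an independent random variable
does not change its law, nor its independence of that variable. -/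
lemma indepFun_and_hasLaw_unitary_mul {S : Type*} [MeasurableSpace S]
    {X : Ω → Matrix (Fin m) (Fin n) K} {Γ : Ω → S} (hX : IsGaussianMatrix X P)
    (hΓ : Measurable Γ) (hind : IndepFun X Γ P) {V : S → Matrix (Fin m) (Fin m) K}
    (hVm : Measurable V) (hV1 : ∀ s, V s * (V s)ᴴ = 1) (hV2 : ∀ s, (V s)ᴴ * V s = 1) :
    IndepFun (fun ω => V (Γ ω) * X ω) Γ P ∧
      MeasurePreserving (fun ω => V (Γ ω) * X ω) P (gaussMat K m n) := by
  have := Measure.isProbabilityMeasure_map (μ := P) hΓ.aemeasurable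
  have hYm : Measurable fun ω => V (Γ ω) * X ω := (hVm.comp hΓ).matrix_mul hX.measurable
  have h1 : MeasurePreserving (fun ω => (Γ ω, X ω)) P ((P.map Γ).prod (gaussMat K m n)) :=
    ⟨hΓ.prodMk hX.measurable, by
      rw [(indepFun_iff_map_prod_eq_prod_map_map hΓ.aemeasurable
        hX.measurable.aemeasurable).1 hind.symm, hX.map_eq]⟩
  have h2 := ((MeasurePreserving.id (P.map Γ)).skew_product (g := fun s Y => V s * Y)
    (μc := gaussMat K m n) (μd := gaussMat K m n)
    ((hVm.comp measurable_fst).matrix_mul measurable_snd)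
    (Filter.Eventually.of_forall fun s =>
      (measurePreserving_mul_left n (hV1 s) (hV2 s)).map_eq)).comp h1
  have h3 : MeasurePreserving (fun ω => V (Γ ω) * X ω) P (gaussMat K m n) :=
    measurePreserving_snd.comp h2
  refine ⟨IndepFun.symm ?_, h3⟩
  rw [indepFun_iff_map_prod_eq_prod_map_map hΓ.aemeasurable hYm.aemeasurable, h3.map_eq]
  exact h2.map_eq

/-- The common form of the real, the complex and the quaternionic case. -/
theorem exists_unitary_conj_eq_jacobi (X : Ω → Matrix (Fin m) (Fin n) K)
    (Γ : Ω → Matrix (Fin m) (Fin m) K) (hX : IsGaussianMatrix X P) (hΓ : Measurable Γ)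
    (hind : IndepFun X Γ P)
    (hrank : ∀ᵐ ω ∂P, (Γ ω).IsHermitian ∧
      (∀ i, ∃ r : ℝ, 0 ≤ r ∧ Γ ω i i = r • (1 : K)) ∧ colRank (Γ ω) = 1) :
    ∃ (x : Fin (min m n) → Ω → ℝ) (y : Fin (min (m - 1) n) → Ω → ℝ)
      (W : Ω → Matrix (Fin (m + n)) (Fin (m + n)) K),
      IsJacobiData (Module.finrank ℝ K) m n x y P ∧
      IndepFun (fun ω => jacobi m n (x · ω) (y · ω)) Γ P ∧
      Measurable W ∧ (∀ ω, W ω ∈ unitary (Matrix (Fin (m + n)) (Fin (m + n)) K)) ∧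
      ∀ᵐ ω ∂P, W ω * chiralPert (Γ ω) (X ω) * star (W ω) =
        (jacobi m n (x · ω) (y · ω) + hsNorm (Γ ω) • corner (m + n)).map
          fun r => r • (1 : K) := by
  obtain ⟨c, hcm, hc⟩ := exists_measurable_column (K := K) m
  obtain ⟨V, hVm, hV1, hV2, hV3⟩ := exists_measurable_unitary_mulVec (K := K) m
  obtain ⟨D, U, hD, hUm, hU1, hU2, hU3, hU4⟩ := exists_tridiagonalization (K := K) (m + n) m n rfl
  obtain ⟨hYind, hY⟩ := indepFun_and_hasLaw_unitary_mul hX hΓ hind (hVm.comp hcm)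
    (fun _ => hV1 _) (fun _ => hV2 _)
  simp only [Function.comp_apply] at hYind hY
  set Y : Ω → Matrix (Fin m) (Fin n) K := fun ω => V (c (Γ ω)) * X ω with hYdef
  have hDY := hD.comp hY
  have hprob := isProbabilityMeasure_offDiagLaw K m n
  have hlaw : ∀ k, HasLaw (fun ω => D (Y ω) k) (offDiagLaw (Module.finrank ℝ K) m n k) P :=
    fun k =>
      have h := (measurePreserving_eval (fun k : Fin (m + n) =>
        offDiagLaw (Module.finrank ℝ K) m n k) k).comp hDY
      ⟨h.measurable.aemeasurable, h.map_eq⟩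
  have hDm : ∀ k, Measurable fun Z => D Z k := fun k => (measurable_pi_apply k).comp hD.measurable
  have hIndep : iIndepFun (fun k ω => D (Y ω) k) P :=
    (iIndepFun_iff_hasLaw_pi_pi hlaw).2 ⟨hDY.measurable.aemeasurable, hDY.map_eq⟩
  have hmeas : ∀ k, Measurable fun ω => D (Y ω) k := fun k => (hDm k).comp hY.measurable
  let e := (finSumFinEquiv (m := m) (n := n)).symm
  refine ⟨fun j ω => D (Y ω) (offDiagIndex m n (Sum.inl j)),
    fun j ω => D (Y ω) (offDiagIndex m n (Sum.inr j)),
    fun ω => (U (Y ω) * extendByOne n (V (c (Γ ω)))).submatrix id e, ⟨fun j => hmeas _,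
      fun j => hmeas _, fun j => ?_, fun j => ?_, ?_⟩, ?_, ?_, fun ω => ?_, ?_⟩
  · rw [← offDiagLaw_inl]
    exact hlaw _
  · rw [← offDiagLaw_inr]
    exact hlaw _
  · convert hIndep.precomp (offDiagIndex_injective m n) using 1
    ext s ω
    rcases s with s | s <;> rfl
  · exact hYind.comp (measurable_jacobi (fun j => hDm (offDiagIndex m n (Sum.inl j)))
      (fun j => hDm (offDiagIndex m n (Sum.inr j)))) measurable_id
  · have h := (hUm.comp hY.measurable).matrix_mul
      (measurable_extendByOne n (hVm.comp (hcm.comp hΓ)))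
    exact measurable_matrix_iff.2 fun i j => h.matrix_apply i (e j)
  · rw [Unitary.mem_iff, star_eq_conjTranspose, conjTranspose_submatrix]
    constructor
    · rw [← submatrix_mul _ _ e id e Function.bijective_id, conjTranspose_mul,
        Matrix.mul_assoc _ (U (Y ω))ᴴ, ← Matrix.mul_assoc (U (Y ω))ᴴ, hU2, Matrix.one_mul,
        conjTranspose_mul_extendByOne n (hV2 _), submatrix_one_equiv]
    · rw [submatrix_mul_equiv, conjTranspose_mul, Matrix.mul_assoc (U (Y ω)),
        ← Matrix.mul_assoc (extendByOne n _), extendByOne_mul_conjTranspose n (hV1 _),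
        Matrix.one_mul, hU1, submatrix_id_id]
  -- the entries beyond the last `x` or `y` have the law `δ₀`, so they vanish almost surely
  · have hzero : ∀ᵐ ω ∂P, ∀ k, k ∉ Set.range (offDiagIndex m n) → D (Y ω) k = 0 := by
      rw [ae_all_iff]
      intro k
      by_cases hk : k ∈ Set.range (offDiagIndex m n)
      · exact Filter.Eventually.of_forall fun ω h => absurd hk h
      · have h := (hlaw k).map_eq
        rw [offDiagLaw_of_notMem_range _ hk] at h
        have h2 : ∀ᵐ r ∂(P.map fun ω => D (Y ω) k), r = 0 := by
          rw [h]
          exact (ae_dirac_iff (p := fun r => r = 0) (measurableSet_singleton (0 : ℝ))).2 rfl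
        filter_upwards [ae_of_ae_map (hmeas k).aemeasurable h2] with ω hω _ using hω
    filter_upwards [hzero, hrank] with ω hω ⟨hherm, hdiag, hone⟩
    obtain ⟨hex, hcol⟩ := rank_one_eq_smul_vecMulVec hherm hdiag hone
    obtain ⟨k, hk, hck⟩ := hc _ hex
    obtain ⟨t, ht, hΓt⟩ := hcol k hk
    rw [← hck] at hΓt
    have hm : 0 < m := k.pos
    have hconj := rank_one_conj ht hΓt (hV3 (c (Γ ω)))
    have hsplit : fromBlocks (V (c (Γ ω)) * Γ ω * (V (c (Γ ω)))ᴴ) (Y ω) (Y ω)ᴴ 0 =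
        fromBlocks 0 (Y ω) (Y ω)ᴴ 0 + fromBlocks (V (c (Γ ω)) * Γ ω * (V (c (Γ ω)))ᴴ) 0 0 0 := by
      simp [fromBlocks_add]
    rw [jacobi_eq_tridiag hω, star_eq_conjTranspose, conjTranspose_submatrix, chiralPert,
      reindex_apply, submatrix_mul_equiv, submatrix_mul_equiv, submatrix_id_id, conjTranspose_mul,
      Matrix.mul_assoc (U (Y ω)), Matrix.mul_assoc (U (Y ω)),
      ← Matrix.mul_assoc _ (extendByOne n _)ᴴ, ← Matrix.mul_assoc (U (Y ω)), extendByOne_conj,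
      hsplit, Matrix.mul_add, Matrix.add_mul, hU4, hconj, fixesFirst_conj_corner (hU3 _) hm,
      Matrix.map_add _ fun a b => add_smul a b (1 : K)]

end General

/-! ### The three division algebras -/

instance : IsStarNormedAlgebra ℝ where
  mul_star_self a := by simp [sq]
  star_mul_self a := by simp [sq]

instance : IsStarNormedAlgebra ℂ where
  mul_star_self a := by simp [Complex.mul_conj']
  star_mul_self a := by simp [Complex.conj_mul']

instance : IsStarNormedAlgebra ℍ[ℝ] where
  star_smul r a := by ext <;> simp
  mul_star_self a := by
    rw [Quaternion.self_mul_star, Quaternion.normSq_eq_norm_mul_self]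
    ext <;> simp [sq]
  star_mul_self a := by
    rw [Quaternion.star_mul_self, Quaternion.normSq_eq_norm_mul_self]
    ext <;> simp [sq]

end ChiralEnsemble

theorem mainTheorem6 {Ω : Type*} [MeasurableSpace Ω] (P : Measure Ω) [IsProbabilityMeasure P]
    (m n : ℕ) :
    (∀ (X : Ω → Matrix (Fin m) (Fin n) ℝ) (Γ : Ω → Matrix (Fin m) (Fin m) ℝ),
      IsGaussianMatrix X P → Measurable Γ → IndepFun X Γ P →
      (∀ᵐ ω ∂P, (Γ ω).PosSemidef ∧ colRank (Γ ω) = 1) →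
      ∃ (x : Fin (min m n) → Ω → ℝ) (y : Fin (min (m - 1) n) → Ω → ℝ)
        (W : Ω → Matrix (Fin (m + n)) (Fin (m + n)) ℝ),
        IsJacobiData 1 m n x y P ∧
        IndepFun (fun ω => jacobi m n (x · ω) (y · ω)) Γ P ∧
        Measurable W ∧ (∀ ω, W ω ∈ unitary (Matrix (Fin (m + n)) (Fin (m + n)) ℝ)) ∧
        ∀ᵐ ω ∂P, W ω * chiralPert (Γ ω) (X ω) * star (W ω) =
          (jacobi m n (x · ω) (y · ω) + hsNorm (Γ ω) • corner (m + n)).map (algebraMap ℝ ℝ)) ∧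
    (∀ (X : Ω → Matrix (Fin m) (Fin n) ℂ) (Γ : Ω → Matrix (Fin m) (Fin m) ℂ),
      IsGaussianMatrix X P → Measurable Γ → IndepFun X Γ P →
      (∀ᵐ ω ∂P, (Γ ω).PosSemidef ∧ colRank (Γ ω) = 1) →
      ∃ (x : Fin (min m n) → Ω → ℝ) (y : Fin (min (m - 1) n) → Ω → ℝ)
        (W : Ω → Matrix (Fin (m + n)) (Fin (m + n)) ℂ),
        IsJacobiData 2 m n x y P ∧
        IndepFun (fun ω => jacobi m n (x · ω) (y · ω)) Γ P ∧
        Measurable W ∧ (∀ ω, W ω ∈ unitary (Matrix (Fin (m + n)) (Fin (m + n)) ℂ)) ∧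
        ∀ᵐ ω ∂P, W ω * chiralPert (Γ ω) (X ω) * star (W ω) =
          (jacobi m n (x · ω) (y · ω) + hsNorm (Γ ω) • corner (m + n)).map (algebraMap ℝ ℂ)) ∧
    (∀ (X : Ω → Matrix (Fin m) (Fin n) ℍ[ℝ]) (Γ : Ω → Matrix (Fin m) (Fin m) ℍ[ℝ]),
      IsGaussianMatrix X P → Measurable Γ → IndepFun X Γ P →
      (∀ᵐ ω ∂P, (Γ ω).PosSemidef ∧ colRank (Γ ω) = 1) →
      ∃ (x : Fin (min m n) → Ω → ℝ) (y : Fin (min (m - 1) n) → Ω → ℝ)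
        (W : Ω → Matrix (Fin (m + n)) (Fin (m + n)) ℍ[ℝ]),
        IsJacobiData 4 m n x y P ∧
        IndepFun (fun ω => jacobi m n (x · ω) (y · ω)) Γ P ∧
        Measurable W ∧ (∀ ω, W ω ∈ unitary (Matrix (Fin (m + n)) (Fin (m + n)) ℍ[ℝ])) ∧
        ∀ᵐ ω ∂P, W ω * chiralPert (Γ ω) (X ω) * star (W ω) =
          (jacobi m n (x · ω) (y · ω) + hsNorm (Γ ω) • corner (m + n)).map (algebraMap ℝ ℍ[ℝ])) := by

  refine ⟨fun X Γ hX hΓ hind h => ?_, fun X Γ hX hΓ hind h => ?_, fun X Γ hX hΓ hind h => ?_⟩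
  · have h := exists_unitary_conj_eq_jacobi X Γ hX hΓ hind (h.mono fun ω hω =>
      ⟨hω.1.1, fun i => ⟨Γ ω i i, hω.1.diag_nonneg, by simp⟩, hω.2⟩)
    have ha : ⇑(algebraMap ℝ ℝ) = fun r => r • (1 : ℝ) := funext Algebra.algebraMap_eq_smul_one
    rw [ha]
    rwa [Module.finrank_self, Nat.cast_one] at h
  · have h := exists_unitary_conj_eq_jacobi X Γ hX hΓ hind (h.mono fun ω hω =>
      ⟨hω.1.1, fun i => by
        obtain ⟨h1, h2⟩ := Complex.nonneg_iff.1 (hω.1.diag_nonneg (i := i))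
        exact ⟨(Γ ω i i).re, h1, by apply Complex.ext <;> simp [← h2]⟩, hω.2⟩)
    have ha : ⇑(algebraMap ℝ ℂ) = fun r => r • (1 : ℂ) := funext Algebra.algebraMap_eq_smul_one
    rw [ha]
    rwa [Complex.finrank_real_complex, Nat.cast_ofNat] at h
  · have h := exists_unitary_conj_eq_jacobi X Γ hX hΓ hind (h.mono fun ω hω =>
      ⟨hω.1.1, fun i => by
        obtain ⟨h1, h2, h3, h4⟩ := hω.1.diag_nonneg (i := i)
        exact ⟨(Γ ω i i).re, h1, by ext <;> simp [← h2, ← h3, ← h4]⟩, hω.2⟩)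
    have ha : ⇑(algebraMap ℝ ℍ[ℝ]) = fun r => r • (1 : ℍ[ℝ]) := funext Algebra.algebraMap_eq_smul_one
    rw [ha]
    rwa [Quaternion.finrank_eq_four, Nat.cast_ofNat] at h
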